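/- Let $p\geq 0$ be an integer and let $\rho:\mathbb{Z}^p\times\mathbb{Z}^p\to\mathbb{T}$ be an antisymmetric bicharacter, i.e. $\rho$ is multiplicative in each variable, $\rho(h,g)=\rho(g,h)^{-1}$ and $\rho(g,g)=1$ for all $g,h$. Write $\rho_{ij}=\rho(e_i,e_j)$ for the standard basis $e_1,\dots,e_p$, and let $A=A_\rho$ be the noncommutative $p$-torus, i.e. the universal $C^*$-algebra generated by unitaries $u_1,\dots,u_p$ subject to $u_ju_i=\rho_{ij}u_iu_j$. Let $\gamma$ be the action of $\mathbb{T}^p\cong(\mathbb{R}/\mathbb{Z})^p$ on $A$ with $\gamma_t(u_j)=e^{2\pi i t_j}u_j$, let $\ell(t)$ be $2\pi$ times the distance from $t$ to $0$ in the metric on $\mathbb{R}^p/\mathbb{Z}^p$ induced from the Euclidean metric on $\mathbb{R}^p$, and for $a\in A$ put $$L(a)=\sup_{t\neq 0}\frac{\|\gamma_t(a)-a\|}{\ell(t)}\in[0,\infty].$$ Let $\tau$ be the state on $A$ with $\tau(a)1=\int_{\mathbb{T}^p}\gamma_t(a)\,dt$ (normalized Haar measure), with GNS representation $\pi_\tau:A\to\mathcal{B}(\mathcal{H}_\tau)$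 and canonical cyclic vector $\xi_\tau$. For a subset $Z$ of a normed space $X$ and $\delta>0$ let $D_X(Z,\delta)\in\{0,1,2,\dots,\infty\}$ be the least dimension of a finite-dimensional linear subspace $V\subset X$ such that every $z\in Z$ satisfies $\|z-x\|<\delta$ for some $x\in V$ ($\infty$ if there is none). For a $^*$-automorphism $\alpha$ of $A$ that is bi-Lipschitz with respect to $L$ (there is $\lambda\geq 0$ with $L(\alpha(a))\leq\lambda L(a)$ and $L(\alpha^{-1}(a))\leq\lambda L(a)$ whenever $L(a)<\infty$), the product entropy is $$\mathrm{Entp}_L(\alpha)=\sup_{\Omega}\,\sup_{\delta>0}\,\limsup_{n\to\infty}\frac1n\log D_A\big(\Omega\cdot\alpha(\Omega)\cdots\alpha^{n-1}(\Omega),\delta\big),$$ where $\Omega$ ranges over the finite subsets of $\{a\in A: L(a)<\infty,\ \|a\|\leq 1\}$, $\Omega\cdot\alpha(\Omega)\cdots\alpha^{n-1}(\Omega)=\{a_1\alpha(a_2)\cdots\alpha^{n-1}(a_n): a_i\in\Omega\}$, and $\log 0=-\infty$. If $\tau\circ\alpha=\tau$, the product entropy $\mathrm{Entp}_{L,\tau}(\alpha)$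 with respect to $\tau$ is defined in the same way with $D_A(Z,\delta)$ replaced by $D_{\mathcal{H}_\tau}(\pi_\tau(Z)\xi_\tau,\delta)$. Then for every unitary $u\in A$ with $L(u)<\infty$, the automorphism $\mathrm{Ad}\,u:a\mapsto uau^*$ is bi-Lipschitz with respect to $L$ and leaves $\tau$ invariant, and $$\mathrm{Entp}_L(\mathrm{Ad}\,u)=\mathrm{Entp}_{L,\tau}(\mathrm{Ad}\,u)=0.$$ -/

import Mathlib

noncomputable section
open scoped ENNReal ComplexOrder

section GroupAlgebra
variable {G : Type*} [Group G]

/-- The involution of the complex group algebra: the conjugate-linear map with `g ↦ g⁻¹`. -/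
def groupAlgebraStar : MonoidAlgebra ℂ G →+ MonoidAlgebra ℂ G :=
  MonoidAlgebra.liftNC
    ((MonoidAlgebra.singleOneRingHom.comp (starRingEnd ℂ) : ℂ →+* MonoidAlgebra ℂ G) :
      ℂ →+ MonoidAlgebra ℂ G) (fun g => MonoidAlgebra.single g⁻¹ 1)

theorem groupAlgebraStar_single (g : G) (c : ℂ) :
    groupAlgebraStar (MonoidAlgebra.single g c) = MonoidAlgebra.single g⁻¹ (star c) := by
  simp [groupAlgebraStar, MonoidAlgebra.single_mul_single]

instance groupAlgebraStarRing : StarRing (MonoidAlgebra ℂ G) where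
  star := groupAlgebraStar
  star_involutive x := by
    induction x using MonoidAlgebra.induction_linear with
    | zero => simp
    | add x y hx hy => simp [hx, hy]
    | single g c => simp [groupAlgebraStar_single]
  star_mul x y := by
    induction x using MonoidAlgebra.induction_linear with
    | zero => simp
    | add x x' hx hx' => simp [add_mul, mul_add, hx, hx']
    | single g c =>
      induction y using MonoidAlgebra.induction_linear with
      | zero => simp
      | add y y' hy hy' => simp [add_mul, mul_add, hy, hy']
      | single h d =>
        simp [groupAlgebraStar_single, MonoidAlgebra.single_mul_single, mul_comm]
  star_add x y := map_add _ x y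

theorem star_single_groupAlgebra (g : G) (c : ℂ) :
    star (MonoidAlgebra.single g c) = MonoidAlgebra.single g⁻¹ (star c) :=
  groupAlgebraStar_single g c

instance groupAlgebraStarModule : StarModule ℂ (MonoidAlgebra ℂ G) where
  star_smul c x := by
    induction x using MonoidAlgebra.induction_linear with
    | zero => simp
    | add x y hx hy => simp [smul_add, hx, hy]
    | single g d => simp [star_single_groupAlgebra]

end GroupAlgebra

/-- An antisymmetric bicharacter `ρ : ℤᵖ × ℤᵖ → 𝕋`. -/
structure AntisymmBicharacter (p : ℕ) where
  toFun : (Fin p → ℤ) → (Fin p → ℤ) → Circle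
  map_add_left : ∀ g g' h, toFun (g + g') h = toFun g h * toFun g' h
  map_add_right : ∀ g h h', toFun g (h + h') = toFun g h * toFun g h'
  map_swap : ∀ g h, toFun h g = (toFun g h)⁻¹
  map_self : ∀ g, toFun g g = 1

/-- The number `ρᵢⱼ = ρ(eᵢ, eⱼ)`. -/
def AntisymmBicharacter.coef {p : ℕ} (ρ : AntisymmBicharacter p) (i j : Fin p) : ℂ :=
  (ρ.toFun (Pi.single i 1) (Pi.single j 1) : ℂ)

/-- The free unital complex *-algebra on `p` unitaries: the group algebra of the free group. -/
abbrev FreeUnitaryAlgebra (p : ℕ) : Type := MonoidAlgebra ℂ (FreeGroup (Fin p))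

/-- The `j`-th free unitary. -/
def freeUnitary {p : ℕ} (j : Fin p) : FreeUnitaryAlgebra p :=
  MonoidAlgebra.single (FreeGroup.of j) 1

/-- C*-seminorms on the free *-algebra on `p` unitaries for which the relations
`uⱼ uᵢ = ρᵢⱼ uᵢ uⱼ` hold. -/
structure IsTorusSeminorm {p : ℕ} (ρ : AntisymmBicharacter p)
    (s : Seminorm ℂ (FreeUnitaryAlgebra p)) : Prop where
  mul_le : ∀ x y, s (x * y) ≤ s x * s y
  star_mul_self : ∀ x, s (star x * x) = s x * s x
  relation : ∀ i j, s (freeUnitary j * freeUnitary i -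
    ρ.coef i j • (freeUnitary i * freeUnitary j)) = 0

section Universal
variable {p : ℕ} {ρ : AntisymmBicharacter p}

theorem IsTorusSeminorm.star_eq {s : Seminorm ℂ (FreeUnitaryAlgebra p)}
    (hs : IsTorusSeminorm ρ s) (x : FreeUnitaryAlgebra p) : s (star x) = s x := by
  have key : ∀ y, s y ≤ s (star y) := by
    intro y
    by_contra! h
    have h1 := hs.mul_le (star y) y
    rw [hs.star_mul_self] at h1
    have h2 := apply_nonneg s (star y)
    nlinarith
  exact le_antisymm (by simpa using key (star x)) (key x)

theorem IsTorusSeminorm.single_le {s : Seminorm ℂ (FreeUnitaryAlgebra p)}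
    (hs : IsTorusSeminorm ρ s) (g : FreeGroup (Fin p)) (c : ℂ) :
    s (MonoidAlgebra.single g c) ≤ ‖c‖ := by
  have h1 : s 1 ≤ 1 := by
    have := hs.star_mul_self 1
    simp only [star_one, mul_one] at this
    nlinarith [apply_nonneg s (1 : FreeUnitaryAlgebra p)]
  have h2 := hs.star_mul_self (MonoidAlgebra.single g c)
  have h3 : star (MonoidAlgebra.single g c) * MonoidAlgebra.single g c =
      (star c * c) • (1 : FreeUnitaryAlgebra p) := by
    simp [star_single_groupAlgebra, MonoidAlgebra.single_mul_single, MonoidAlgebra.one_def]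
  rw [h3, map_smul_eq_mul, norm_mul, norm_star] at h2
  have h4 := apply_nonneg s (MonoidAlgebra.single g c : FreeUnitaryAlgebra p)
  have h5 := norm_nonneg c
  have h6 := apply_nonneg s (1 : FreeUnitaryAlgebra p)
  refine abs_le_of_sq_le_sq' ?_ h5 |>.2
  nlinarith [mul_nonneg h5 h5]

theorem bddAbove_torusSeminorm (ρ : AntisymmBicharacter p) (x : FreeUnitaryAlgebra p) :
    BddAbove (Set.range fun s : {s // IsTorusSeminorm ρ s} => s.1 x) := by
  induction x using MonoidAlgebra.induction_linear with
  | zero => exact ⟨0, by rintro _ ⟨s, rfl⟩; simp⟩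
  | add x y hx hy =>
    obtain ⟨a, ha⟩ := hx
    obtain ⟨b, hb⟩ := hy
    refine ⟨a + b, ?_⟩
    rintro _ ⟨s, rfl⟩
    exact (map_add_le_add s.1 x y).trans (add_le_add (ha ⟨s, rfl⟩) (hb ⟨s, rfl⟩))
  | single g c => exact ⟨‖c‖, by rintro _ ⟨s, rfl⟩; exact s.2.single_le g c⟩

instance (ρ : AntisymmBicharacter p) : Nonempty {s // IsTorusSeminorm ρ s} :=
  ⟨⟨0, ⟨by simp, by simp, by simp⟩⟩⟩

/-- The greatest C*-seminorm for which the relations hold. -/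
def torusSeminorm (ρ : AntisymmBicharacter p) (x : FreeUnitaryAlgebra p) : ℝ :=
  ⨆ s : {s // IsTorusSeminorm ρ s}, s.1 x

theorem le_torusSeminorm {s : Seminorm ℂ (FreeUnitaryAlgebra p)} (hs : IsTorusSeminorm ρ s)
    (x : FreeUnitaryAlgebra p) : s x ≤ torusSeminorm ρ x :=
  le_ciSup (bddAbove_torusSeminorm ρ x) ⟨s, hs⟩

theorem torusSeminorm_le {x : FreeUnitaryAlgebra p} {c : ℝ}
    (h : ∀ s : Seminorm ℂ (FreeUnitaryAlgebra p), IsTorusSeminorm ρ s → s x ≤ c) :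
    torusSeminorm ρ x ≤ c := ciSup_le fun s => h s.1 s.2

theorem torusSeminorm_nonneg (x : FreeUnitaryAlgebra p) : 0 ≤ torusSeminorm ρ x :=
  Real.iSup_nonneg fun s => apply_nonneg s.1 x

theorem torusSeminorm_mul_le (x y : FreeUnitaryAlgebra p) :
    torusSeminorm ρ (x * y) ≤ torusSeminorm ρ x * torusSeminorm ρ y :=
  torusSeminorm_le fun s hs => (hs.mul_le x y).trans
    (mul_le_mul (le_torusSeminorm hs x) (le_torusSeminorm hs y) (apply_nonneg s y)
      (torusSeminorm_nonneg x))

theorem torusSeminorm_star_mul_self (x : FreeUnitaryAlgebra p) :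
    torusSeminorm ρ x * torusSeminorm ρ x ≤ torusSeminorm ρ (star x * x) := by
  have h0 := torusSeminorm_nonneg (ρ := ρ) (star x * x)
  have h1 : torusSeminorm ρ x ≤ √(torusSeminorm ρ (star x * x)) :=
    torusSeminorm_le fun s hs => Real.le_sqrt_of_sq_le (by
      rw [sq, ← hs.star_mul_self]
      exact le_torusSeminorm hs _)
  calc torusSeminorm ρ x * torusSeminorm ρ x
      ≤ √(torusSeminorm ρ (star x * x)) * √(torusSeminorm ρ (star x * x)) :=
        mul_self_le_mul_self (torusSeminorm_nonneg x) h1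
    _ = _ := Real.mul_self_sqrt h0

theorem torusSeminorm_star (x : FreeUnitaryAlgebra p) :
    torusSeminorm ρ (star x) = torusSeminorm ρ x := by
  unfold torusSeminorm
  exact iSup_congr fun s => s.2.star_eq x

theorem torusSeminorm_smul_le (c : ℂ) (x : FreeUnitaryAlgebra p) :
    torusSeminorm ρ (c • x) ≤ ‖c‖ * torusSeminorm ρ x :=
  torusSeminorm_le fun s hs => by
    rw [map_smul_eq_mul]
    exact mul_le_mul_of_nonneg_left (le_torusSeminorm hs x) (norm_nonneg c)

/-- `torusSeminorm ρ` as a bundled ring seminorm. -/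
def torusRingSeminorm (ρ : AntisymmBicharacter p) : RingSeminorm (FreeUnitaryAlgebra p) where
  toFun := torusSeminorm ρ
  map_zero' := le_antisymm (torusSeminorm_le (by simp)) (torusSeminorm_nonneg 0)
  add_le' x y := torusSeminorm_le fun s hs => (map_add_le_add s x y).trans
    (add_le_add (le_torusSeminorm hs x) (le_torusSeminorm hs y))
  neg' x := by unfold torusSeminorm; exact iSup_congr fun s => map_neg_eq_map s.1 x
  mul_le' := torusSeminorm_mul_le

/-- The free *-algebra on `p` unitaries, seminormed by `torusSeminorm ρ`. -/
def PreNCTorus (_ρ : AntisymmBicharacter p) : Type := FreeUnitaryAlgebra p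

instance : SeminormedRing (PreNCTorus ρ) := (torusRingSeminorm ρ).toSeminormedRing
instance : StarRing (PreNCTorus ρ) := inferInstanceAs (StarRing (FreeUnitaryAlgebra p))
instance : Algebra ℂ (PreNCTorus ρ) := inferInstanceAs (Algebra ℂ (FreeUnitaryAlgebra p))
instance : StarModule ℂ (PreNCTorus ρ) := inferInstanceAs (StarModule ℂ (FreeUnitaryAlgebra p))
instance : NormedAlgebra ℂ (PreNCTorus ρ) where
  norm_smul_le c x := torusSeminorm_smul_le (ρ := ρ) c x

theorem PreNCTorus.norm_def (x : PreNCTorus ρ) : ‖x‖ = torusSeminorm ρ x := rfl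

theorem PreNCTorus.norm_star (x : PreNCTorus ρ) : ‖star x‖ = ‖x‖ := torusSeminorm_star x

instance : NormedStarGroup (PreNCTorus ρ) := ⟨fun x => (PreNCTorus.norm_star x).le⟩

/-- The noncommutative `p`-torus `A_ρ`: the universal C*-algebra generated by unitaries
`u₁, …, u_p` with `uⱼ uᵢ = ρᵢⱼ uᵢ uⱼ`, that is, the Hausdorff completion of the free *-algebra on
`p` unitaries in the greatest C*-seminorm for which these relations hold. -/
def NCTorus (ρ : AntisymmBicharacter p) : Type := UniformSpace.Completion (PreNCTorus ρ)

open UniformSpace in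
instance : NormedRing (NCTorus ρ) := inferInstanceAs (NormedRing (Completion (PreNCTorus ρ)))
open UniformSpace in
instance : Algebra ℂ (NCTorus ρ) := inferInstanceAs (Algebra ℂ (Completion (PreNCTorus ρ)))
open UniformSpace in
instance : CompleteSpace (NCTorus ρ) :=
  inferInstanceAs (CompleteSpace (Completion (PreNCTorus ρ)))

/-- The canonical map of the free *-algebra into `A_ρ`. -/
def NCTorus.mk (ρ : AntisymmBicharacter p) : PreNCTorus ρ →+* NCTorus ρ :=
  UniformSpace.Completion.coeRingHom

theorem NCTorus.norm_mk (x : PreNCTorus ρ) : ‖NCTorus.mk ρ x‖ = ‖x‖ :=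
  UniformSpace.Completion.norm_coe x

theorem NCTorus.continuous_mk : Continuous (NCTorus.mk ρ) :=
  UniformSpace.Completion.continuous_coe _

theorem NCTorus.denseRange_mk : DenseRange (NCTorus.mk ρ) :=
  UniformSpace.Completion.denseRange_coe

theorem NCTorus.mk_algebraMap (c : ℂ) :
    NCTorus.mk ρ (algebraMap ℂ (PreNCTorus ρ) c) = algebraMap ℂ (NCTorus ρ) c := rfl

theorem NCTorus.mk_smul (c : ℂ) (x : PreNCTorus ρ) :
    NCTorus.mk ρ (c • x) = c • NCTorus.mk ρ x := by
  rw [Algebra.smul_def, Algebra.smul_def, map_mul, NCTorus.mk_algebraMap]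

instance : NormedAlgebra ℂ (NCTorus ρ) where
  norm_smul_le c x := by
    refine NCTorus.denseRange_mk.induction_on x ?_ ?_
    · refine isClosed_le ?_ (by fun_prop)
      simp_rw [Algebra.smul_def]
      fun_prop
    · intro a
      rw [← NCTorus.mk_smul, NCTorus.norm_mk, NCTorus.norm_mk]
      exact norm_smul_le c a

instance : Star (NCTorus ρ) :=
  ⟨UniformSpace.Completion.map (star : PreNCTorus ρ → PreNCTorus ρ)⟩

theorem NCTorus.continuous_star : Continuous (star : NCTorus ρ → NCTorus ρ) :=
  UniformSpace.Completion.continuous_map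

theorem NCTorus.star_mk (x : PreNCTorus ρ) :
    star (NCTorus.mk ρ x) = NCTorus.mk ρ (star x) :=
  UniformSpace.Completion.map_coe (star_isometry.uniformContinuous) x

instance : StarRing (NCTorus ρ) where
  star_involutive x := by
    refine NCTorus.denseRange_mk.induction_on x
      (isClosed_eq (NCTorus.continuous_star.comp NCTorus.continuous_star) continuous_id) fun a => ?_
    rw [NCTorus.star_mk, NCTorus.star_mk, star_star]
  star_mul x y := by
    have h := NCTorus.continuous_star (ρ := ρ)
    refine NCTorus.denseRange_mk.induction_on₂ (p := fun x y => star (x * y) = star y * star x)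
      ?_ ?_ x y
    · exact isClosed_eq (by fun_prop) (by fun_prop)
    · intro a b
      rw [← map_mul, NCTorus.star_mk, NCTorus.star_mk, NCTorus.star_mk, star_mul, map_mul]
  star_add x y := by
    have h := NCTorus.continuous_star (ρ := ρ)
    refine NCTorus.denseRange_mk.induction_on₂ (p := fun x y => star (x + y) = star x + star y)
      ?_ ?_ x y
    · exact isClosed_eq (by fun_prop) (by fun_prop)
    · intro a b
      rw [← map_add, NCTorus.star_mk, NCTorus.star_mk, NCTorus.star_mk, star_add, map_add]

instance : StarModule ℂ (NCTorus ρ) where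
  star_smul c x := by
    have h := NCTorus.continuous_star (ρ := ρ)
    refine NCTorus.denseRange_mk.induction_on x (isClosed_eq (h.comp (continuous_const_smul c))
      ((continuous_const_smul (star c)).comp h)) fun a => ?_
    rw [← NCTorus.mk_smul, NCTorus.star_mk, NCTorus.star_mk, star_smul, NCTorus.mk_smul]

instance : CStarRing (NCTorus ρ) where
  norm_mul_self_le x := by
    have h := NCTorus.continuous_star (ρ := ρ)
    refine NCTorus.denseRange_mk.induction_on x (isClosed_le (by fun_prop) (by fun_prop)) fun a => ?_
    rw [NCTorus.star_mk, ← map_mul, NCTorus.norm_mk, NCTorus.norm_mk]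
    exact torusSeminorm_star_mul_self (ρ := ρ) a

instance : CStarAlgebra (NCTorus ρ) where

/-- The usual order of the C*-algebra `A_ρ`. -/
instance : PartialOrder (NCTorus ρ) := CStarAlgebra.spectralOrder _
instance : StarOrderedRing (NCTorus ρ) := CStarAlgebra.spectralOrderedRing _

/-- The canonical *-homomorphism of the free *-algebra on `p` unitaries into `A_ρ`. -/
def NCTorus.ofFree (ρ : AntisymmBicharacter p) : FreeUnitaryAlgebra p →⋆ₐ[ℂ] NCTorus ρ where
  toFun x := NCTorus.mk ρ x
  map_one' := map_one (NCTorus.mk ρ)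
  map_mul' x y := map_mul (NCTorus.mk ρ) x y
  map_zero' := map_zero (NCTorus.mk ρ)
  map_add' x y := map_add (NCTorus.mk ρ) x y
  commutes' c := NCTorus.mk_algebraMap c
  map_star' x := (NCTorus.star_mk (ρ := ρ) x).symm

theorem NCTorus.norm_ofFree (x : FreeUnitaryAlgebra p) :
    ‖NCTorus.ofFree ρ x‖ = torusSeminorm ρ x := NCTorus.norm_mk (ρ := ρ) x

theorem NCTorus.denseRange_ofFree : DenseRange (NCTorus.ofFree ρ) := NCTorus.denseRange_mk

section Lift
variable {B : Type*} [CStarAlgebra B]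

/-- The *-homomorphism of the free *-algebra on `p` unitaries sending them to given unitaries. -/
def freeLift (v : Fin p → unitary B) : FreeUnitaryAlgebra p →ₐ[ℂ] B :=
  MonoidAlgebra.lift ℂ B (FreeGroup (Fin p)) ((unitary B).subtype.comp (FreeGroup.lift v))

theorem freeLift_single (v : Fin p → unitary B) (g : FreeGroup (Fin p)) (c : ℂ) :
    freeLift v (MonoidAlgebra.single g c) = c • (FreeGroup.lift v g : B) := by
  simp [freeLift]

theorem freeLift_star (v : Fin p → unitary B) (x : FreeUnitaryAlgebra p) :
    freeLift v (star x) = star (freeLift v x) := by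
  induction x using MonoidAlgebra.induction_linear with
  | zero => simp
  | add x y hx hy => simp [hx, hy]
  | single g c =>
    rw [star_single_groupAlgebra, freeLift_single, freeLift_single, star_smul, map_inv,
      ← Unitary.star_eq_inv, Unitary.coe_star]

theorem isTorusSeminorm_freeLift (v : Fin p → unitary B)
    (hv : ∀ i j, (v j * v i : B) = ρ.coef i j • (v i * v j : B)) :
    IsTorusSeminorm ρ ((normSeminorm ℂ B).comp (freeLift v).toLinearMap) where
  mul_le x y := by simpa using norm_mul_le (freeLift v x) (freeLift v y)
  star_mul_self x := by
    simpa [freeLift_star] using CStarRing.norm_star_mul_self (x := freeLift v x)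
  relation i j := by
    simp [freeUnitary, freeLift_single, hv i j]

/-- `freeLift v` on the seminormed algebra `PreNCTorus ρ`, as a ring homomorphism. -/
def preLift (ρ : AntisymmBicharacter p) (v : Fin p → unitary B) : PreNCTorus ρ →+* B :=
  (freeLift v).toRingHom

theorem continuous_preLift (v : Fin p → unitary B)
    (hv : ∀ i j, (v j * v i : B) = ρ.coef i j • (v i * v j : B)) : Continuous (preLift ρ v) :=
  AddMonoidHomClass.continuous_of_bound (preLift ρ v) 1 fun x => by
    rw [one_mul]
    exact le_torusSeminorm (isTorusSeminorm_freeLift v hv) x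

/-- The ring homomorphism underlying `NCTorus.lift`. -/
def NCTorus.liftRingHom (v : Fin p → unitary B)
    (hv : ∀ i j, (v j * v i : B) = ρ.coef i j • (v i * v j : B)) : NCTorus ρ →+* B :=
  UniformSpace.Completion.extensionHom (preLift ρ v) (continuous_preLift v hv)

theorem NCTorus.liftRingHom_ofFree (v : Fin p → unitary B)
    (hv : ∀ i j, (v j * v i : B) = ρ.coef i j • (v i * v j : B)) (x : FreeUnitaryAlgebra p) :
    NCTorus.liftRingHom v hv (NCTorus.ofFree ρ x) = freeLift v x :=
  UniformSpace.Completion.extensionHom_coe (preLift ρ v) (continuous_preLift v hv) x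

theorem NCTorus.continuous_liftRingHom (v : Fin p → unitary B)
    (hv : ∀ i j, (v j * v i : B) = ρ.coef i j • (v i * v j : B)) :
    Continuous (NCTorus.liftRingHom v hv) :=
  UniformSpace.Completion.continuous_extension

/-- The universal property of `A_ρ`: unitaries of a C*-algebra which satisfy the relations are the
images of the generators under a *-homomorphism. -/
def NCTorus.lift (v : Fin p → unitary B)
    (hv : ∀ i j, (v j * v i : B) = ρ.coef i j • (v i * v j : B)) : NCTorus ρ →⋆ₐ[ℂ] B where
  __ := NCTorus.liftRingHom v hv
  commutes' c := by
    change NCTorus.liftRingHom v hv (algebraMap ℂ (NCTorus ρ) c) = _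
    rw [← AlgHomClass.commutes (NCTorus.ofFree ρ), NCTorus.liftRingHom_ofFree, AlgHom.commutes]
  map_star' x := by
    change NCTorus.liftRingHom v hv (star x) = star (NCTorus.liftRingHom v hv x)
    have h := NCTorus.continuous_liftRingHom v hv
    refine NCTorus.denseRange_ofFree.induction_on x
      (isClosed_eq (h.comp NCTorus.continuous_star)
        h.star) fun a => ?_
    rw [← map_star, NCTorus.liftRingHom_ofFree, NCTorus.liftRingHom_ofFree, freeLift_star]

theorem NCTorus.lift_ofFree (v : Fin p → unitary B)
    (hv : ∀ i j, (v j * v i : B) = ρ.coef i j • (v i * v j : B)) (x : FreeUnitaryAlgebra p) :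
    NCTorus.lift v hv (NCTorus.ofFree ρ x) = freeLift v x := NCTorus.liftRingHom_ofFree v hv x

end Lift

theorem freeUnitary_mem_unitary (j : Fin p) :
    (freeUnitary j : FreeUnitaryAlgebra p) ∈ unitary (FreeUnitaryAlgebra p) := by
  simp [Unitary.mem_iff, freeUnitary, star_single_groupAlgebra, MonoidAlgebra.single_mul_single,
    MonoidAlgebra.one_def]

/-- The canonical generating unitaries `u₁, …, u_p` of `A_ρ`. -/
def NCTorus.gen (ρ : AntisymmBicharacter p) (j : Fin p) : unitary (NCTorus ρ) :=
  ⟨NCTorus.ofFree ρ (freeUnitary j), by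
    have h := freeUnitary_mem_unitary j
    rw [Unitary.mem_iff] at h ⊢
    rw [← map_star, ← map_mul, ← map_mul, h.1, h.2]
    simp⟩

theorem NCTorus.gen_mul_gen (i j : Fin p) :
    (NCTorus.gen ρ j * NCTorus.gen ρ i : NCTorus ρ) =
      ρ.coef i j • (NCTorus.gen ρ i * NCTorus.gen ρ j : NCTorus ρ) := by
  have h : ‖NCTorus.ofFree ρ (freeUnitary j * freeUnitary i -
      ρ.coef i j • (freeUnitary i * freeUnitary j))‖ = 0 := by
    rw [NCTorus.norm_ofFree]
    exact le_antisymm (torusSeminorm_le fun s hs => (hs.relation i j).le) (torusSeminorm_nonneg _)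
  have h2 := norm_eq_zero.1 h
  rw [map_sub, map_smul, map_mul, map_mul, sub_eq_zero] at h2
  exact h2

theorem NCTorus.ofFree_single (g : FreeGroup (Fin p)) (c : ℂ) :
    NCTorus.ofFree ρ (MonoidAlgebra.single g c) =
      c • (FreeGroup.lift (NCTorus.gen ρ) g : NCTorus ρ) := by
  have h : ((NCTorus.ofFree ρ : FreeUnitaryAlgebra p →* NCTorus ρ)).comp
      (MonoidAlgebra.of ℂ (FreeGroup (Fin p))) =
      (unitary (NCTorus ρ)).subtype.comp (FreeGroup.lift (NCTorus.gen ρ)) := by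
    refine FreeGroup.ext_hom _ _ fun j => ?_
    simp [NCTorus.gen, freeUnitary]
  have h2 := DFunLike.congr_fun h g
  rw [show (MonoidAlgebra.single g c : FreeUnitaryAlgebra p) = c • MonoidAlgebra.single g 1 by simp,
    map_smul]
  congr 1

/-- The phase rotation of the generators by `t ∈ 𝕋ᵖ = (ℝ/ℤ)ᵖ`:  `uⱼ ↦ exp(2πi tⱼ) uⱼ`. -/
def NCTorus.rotatedGen (ρ : AntisymmBicharacter p) (t : UnitAddTorus (Fin p)) (j : Fin p) :
    unitary (NCTorus ρ) :=
  ⟨(AddCircle.toCircle (t j) : ℂ) • (NCTorus.gen ρ j : NCTorus ρ), by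
    have h := (NCTorus.gen ρ j).2
    rw [Unitary.mem_iff] at h ⊢
    rw [star_smul, smul_mul_smul_comm, smul_mul_smul_comm, h.1, h.2]
    simp only [Complex.star_def, Complex.conj_mul', Complex.mul_conj', Circle.norm_coe]
    simp⟩

/-- The canonical action `γ` of `𝕋ᵖ` on `A_ρ`, determined by `γ_t(uⱼ) = exp(2πi tⱼ) uⱼ`. -/
def NCTorus.act (ρ : AntisymmBicharacter p) (t : UnitAddTorus (Fin p)) :
    NCTorus ρ →⋆ₐ[ℂ] NCTorus ρ :=
  NCTorus.lift (NCTorus.rotatedGen ρ t) fun i j => by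
    simp only [NCTorus.rotatedGen, smul_mul_smul_comm, NCTorus.gen_mul_gen i j]
    rw [smul_smul, smul_smul]
    congr 1
    ring

theorem NCTorus.act_gen (t : UnitAddTorus (Fin p)) (j : Fin p) :
    NCTorus.act ρ t (NCTorus.gen ρ j) =
      (AddCircle.toCircle (t j) : ℂ) • (NCTorus.gen ρ j : NCTorus ρ) := by
  unfold NCTorus.act
  refine (NCTorus.lift_ofFree _ _ _).trans ?_
  simp [freeUnitary, freeLift_single, NCTorus.rotatedGen]
section Nontrivial

theorem AntisymmBicharacter.map_zero_left (ρ : AntisymmBicharacter p) (h : Fin p → ℤ) :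
    ρ.toFun 0 h = 1 := by
  have := ρ.map_add_left 0 0 h
  simpa using this

/-- The space `ℓ²(ℤᵖ)`. -/
abbrev TorusL2 (p : ℕ) : Type := lp (fun _ : Fin p → ℤ => ℂ) 2

/-- The weighted translation `f ↦ (k ↦ φ(k) f(σ(k)))` of `ℓ²(ℤᵖ)`. -/
def weightedShiftFun (φ : (Fin p → ℤ) → Circle) (σ : Equiv.Perm (Fin p → ℤ))
    (f : TorusL2 p) : TorusL2 p :=
  ⟨fun k => (φ k : ℂ) * f (σ k), by
    have h := lp.memℓp f
    have h2 : 0 < (2 : ℝ≥0∞).toReal := by norm_num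
    change Memℓp (fun k => (φ k : ℂ) * f (σ k)) 2
    rw [memℓp_gen_iff h2] at h ⊢
    simpa only [Function.comp_def, norm_mul, Circle.norm_coe, one_mul] using (σ.summable_iff).2 h⟩

theorem weightedShiftFun_apply (φ : (Fin p → ℤ) → Circle) (σ : Equiv.Perm (Fin p → ℤ))
    (f : TorusL2 p) (k : Fin p → ℤ) :
    weightedShiftFun φ σ f k = (φ k : ℂ) * f (σ k) := rfl

/-- `weightedShiftFun` as a unitary operator. -/
def weightedShift (φ : (Fin p → ℤ) → Circle) (σ : Equiv.Perm (Fin p → ℤ)) :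
    TorusL2 p ≃ₗᵢ[ℂ] TorusL2 p where
  toFun := weightedShiftFun φ σ
  map_add' f g := by
    ext k
    simp [weightedShiftFun_apply, mul_add]
  map_smul' c f := by
    ext k
    simp [weightedShiftFun_apply, mul_left_comm]
  invFun := weightedShiftFun (fun k => (φ (σ.symm k))⁻¹) σ.symm
  left_inv f := by
    ext k
    simp [weightedShiftFun_apply]
  right_inv f := by
    ext k
    simp [weightedShiftFun_apply]
  norm_map' f := by
    have h2 : 0 < (2 : ℝ≥0∞).toReal := by norm_num
    rw [lp.norm_eq_tsum_rpow h2, lp.norm_eq_tsum_rpow h2]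
    congr 1
    rw [← σ.tsum_eq fun k => ‖f k‖ ^ (2 : ℝ≥0∞).toReal]
    refine tsum_congr fun k => ?_
    change ‖weightedShiftFun φ σ f k‖ ^ _ = _
    rw [weightedShiftFun_apply, norm_mul, Circle.norm_coe, one_mul]

/-- Restriction of a point of `ℤᵖ` to the coordinates below `j`. -/
def lowerPart (j : Fin p) (k : Fin p → ℤ) : Fin p → ℤ := fun i => if i < j then k i else 0

theorem lowerPart_add_single (i j : Fin p) (k : Fin p → ℤ) :
    lowerPart j (k + Pi.single i 1) =
      lowerPart j k + if i < j then Pi.single i 1 else 0 := by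
  ext l
  by_cases h : i < j
  · by_cases hl : l = i
    · subst hl; simp [lowerPart, h]
    · simp [lowerPart, h, hl]
  · by_cases hl : l = i
    · subst hl; simp [lowerPart, h]
    · simp [lowerPart, h, hl]

/-- The unitaries of a representation of `A_ρ` on `ℓ²(ℤᵖ)`. -/
def shiftUnitary (ρ : AntisymmBicharacter p) (j : Fin p) :
    unitary (TorusL2 p →L[ℂ] TorusL2 p) :=
  Unitary.linearIsometryEquiv.symm
    (weightedShift (fun k => (ρ.toFun (lowerPart j k) (Pi.single j 1))⁻¹)
      (Equiv.addRight (Pi.single j 1)))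

theorem shiftUnitary_apply (ρ : AntisymmBicharacter p) (j : Fin p) (f : TorusL2 p)
    (k : Fin p → ℤ) :
    (shiftUnitary ρ j : TorusL2 p →L[ℂ] TorusL2 p) f k =
      ((ρ.toFun (lowerPart j k) (Pi.single j 1))⁻¹ : Circle) * f (k + Pi.single j 1) := rfl

theorem shiftUnitary_relation (ρ : AntisymmBicharacter p) (i j : Fin p) :
    (shiftUnitary ρ j * shiftUnitary ρ i : TorusL2 p →L[ℂ] TorusL2 p) =
      ρ.coef i j • (shiftUnitary ρ i * shiftUnitary ρ j : TorusL2 p →L[ℂ] TorusL2 p) := by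
  ext f k
  simp only [mul_apply_eq_comp, smul_apply, lp.coeFn_smul,
    Pi.smul_apply, smul_eq_mul, shiftUnitary_apply, AntisymmBicharacter.coef]
  rw [add_right_comm k (Pi.single j 1) (Pi.single i 1), ← mul_assoc, ← mul_assoc, ← mul_assoc]
  congr 1
  norm_cast
  rw [lowerPart_add_single, lowerPart_add_single, ρ.map_add_left, ρ.map_add_left]
  rcases lt_trichotomy i j with h | h | h
  · simp only [h, h.not_gt, if_true, if_false, ρ.map_zero_left, mul_one, mul_inv]
    rw [mul_comm (ρ.toFun (Pi.single i 1) (Pi.single j 1)), mul_assoc, mul_comm]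
    simp
  · subst h
    simp [ρ.map_zero_left, ρ.map_self]
  · simp [h, h.not_gt, ρ.map_zero_left, ρ.map_swap (Pi.single i 1) (Pi.single j 1), mul_comm]

instance (ρ : AntisymmBicharacter p) : Nontrivial (NCTorus ρ) := by
  have : Nontrivial (TorusL2 p) :=
    ⟨⟨lp.single 2 0 1, 0, fun h => by
      have := congrArg (fun f : TorusL2 p => f 0) h
      simp at this⟩⟩
  exact (NCTorus.lift (shiftUnitary ρ) (shiftUnitary_relation ρ)).toRingHom.domain_nontrivial

end Nontrivial

/-- The exponents of the generators in an element of the free group. -/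
def exponents (p : ℕ) : FreeGroup (Fin p) →* Multiplicative (Fin p → ℤ) :=
  FreeGroup.lift fun j => Multiplicative.ofAdd (Pi.single j 1)

/-- The unitary of `A_ρ` which is the given word in the generators. -/
def NCTorus.word (ρ : AntisymmBicharacter p) : FreeGroup (Fin p) →* unitary (NCTorus ρ) :=
  FreeGroup.lift (NCTorus.gen ρ)

theorem NCTorus.act_word (t : UnitAddTorus (Fin p)) (g : FreeGroup (Fin p)) :
    NCTorus.act ρ t (NCTorus.word ρ g) =
      UnitAddTorus.mFourier (exponents p g).toAdd t • (NCTorus.word ρ g : NCTorus ρ) := by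
  induction g using FreeGroup.induction_on with
  | C1 => simp [UnitAddTorus.mFourier_zero]
  | of j =>
    simp [exponents, NCTorus.word, UnitAddTorus.mFourier_single, NCTorus.act_gen]
  | inv_of j h =>
    rw [map_inv, map_inv, ← Unitary.star_eq_inv, Unitary.coe_star, map_star, h, star_smul,
      toAdd_inv, UnitAddTorus.mFourier_neg]
    rfl
  | mul g h hg hh =>
    rw [map_mul, map_mul, Submonoid.coe_mul, map_mul, hg, hh, smul_mul_smul_comm, toAdd_mul,
      UnitAddTorus.mFourier_add]

theorem NCTorus.norm_act_le (t : UnitAddTorus (Fin p)) (a : NCTorus ρ) :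
    ‖NCTorus.act ρ t a‖ ≤ ‖a‖ := NonUnitalStarAlgHom.norm_apply_le _ a

theorem NCTorus.continuous_act (a : NCTorus ρ) : Continuous fun t => NCTorus.act ρ t a := by
  have h : ∀ x, Continuous fun t => NCTorus.act ρ t (NCTorus.ofFree ρ x) := by
    intro x
    induction x using MonoidAlgebra.induction_linear with
    | zero => simpa using continuous_const
    | add x y hx hy => simp_rw [map_add]; exact Continuous.add hx hy
    | single g c =>
      simp_rw [NCTorus.ofFree_single, map_smul]
      change Continuous fun t => c • NCTorus.act ρ t (NCTorus.word ρ g)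
      simp_rw [NCTorus.act_word]
      exact ((UnitAddTorus.mFourier (exponents p g).toAdd).continuous.smul continuous_const).const_smul c
  refine continuous_of_uniform_approx_of_continuous fun U hU => ?_
  obtain ⟨ε, hε, hεU⟩ := Metric.mem_uniformity_dist.1 hU
  obtain ⟨x, hx⟩ := NCTorus.denseRange_ofFree.exists_dist_lt a hε
  refine ⟨_, h x, fun t => hεU ?_⟩
  rw [dist_eq_norm] at hx ⊢
  rw [← map_sub]
  exact (NCTorus.norm_act_le t _).trans_lt hx

/-- The unitaries which are scalar multiples of the unit. -/
def scalarUnitaries (ρ : AntisymmBicharacter p) : Subgroup (unitary (NCTorus ρ)) where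
  carrier := {z | ∃ c : ℂ, (z : NCTorus ρ) = algebraMap ℂ _ c}
  one_mem' := ⟨1, by simp⟩
  mul_mem' := by
    rintro a b ⟨c, hc⟩ ⟨d, hd⟩
    exact ⟨c * d, by simp [hc, hd]⟩
  inv_mem' := by
    rintro a ⟨c, hc⟩
    exact ⟨star c, by
      rw [← Unitary.star_eq_inv, Unitary.coe_star, hc, algebraMap_star_comm]⟩

instance (ρ : AntisymmBicharacter p) : (scalarUnitaries ρ).Normal where
  conj_mem := by
    rintro a ⟨c, hc⟩ g
    refine ⟨c, ?_⟩
    rw [Submonoid.coe_mul, Submonoid.coe_mul, hc, ← Algebra.commutes, mul_assoc,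
      ← Submonoid.coe_mul, mul_inv_cancel]
    simp

theorem AntisymmBicharacter.coef_ne_zero (ρ : AntisymmBicharacter p) (i j : Fin p) :
    ρ.coef i j ≠ 0 := Circle.coe_ne_zero _

theorem NCTorus.commute_gen (i j : Fin p) :
    Commute (QuotientGroup.mk' (scalarUnitaries ρ) (NCTorus.gen ρ i))
      (QuotientGroup.mk' (scalarUnitaries ρ) (NCTorus.gen ρ j)) := by
  rw [Commute, SemiconjBy, ← map_mul, ← map_mul, QuotientGroup.mk'_apply, QuotientGroup.mk'_apply,
    QuotientGroup.eq]
  refine ⟨ρ.coef i j, ?_⟩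
  rw [Submonoid.coe_mul, Submonoid.coe_mul, NCTorus.gen_mul_gen i j, mul_smul_comm,
    ← Submonoid.coe_mul, ← Submonoid.coe_mul, inv_mul_cancel, Algebra.algebraMap_eq_smul_one]
  rfl

theorem NCTorus.word_mem_scalarUnitaries {g : FreeGroup (Fin p)} (hg : exponents p g = 1) :
    NCTorus.word ρ g ∈ scalarUnitaries ρ := by
  let q : Fin p → unitary (NCTorus ρ) ⧸ scalarUnitaries ρ := fun j =>
    QuotientGroup.mk' (scalarUnitaries ρ) (NCTorus.gen ρ j)
  let ψ : (Fin p → Multiplicative ℤ) →* unitary (NCTorus ρ) ⧸ scalarUnitaries ρ :=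
    MonoidHom.noncommPiCoprod (fun j => zpowersHom _ (q j)) fun i j _ x y => by
      simp only [zpowersHom_apply]
      exact ((NCTorus.commute_gen i j).zpow_zpow _ _)
  let f : FreeGroup (Fin p) →* (Fin p → Multiplicative ℤ) :=
    { toFun := fun g i => Multiplicative.ofAdd ((exponents p g).toAdd i)
      map_one' := by ext i; simp
      map_mul' := by intro a b; ext i; simp }
  have h : (QuotientGroup.mk' (scalarUnitaries ρ)).comp (NCTorus.word ρ) = ψ.comp f := by
    refine FreeGroup.ext_hom _ _ fun j => ?_
    have hf : f (FreeGroup.of j) = Pi.mulSingle j (Multiplicative.ofAdd 1) := by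
      ext i
      by_cases hi : i = j
      · subst hi; simp [f, exponents]
      · simp [f, exponents, hi]
    simp [hf, ψ, q, NCTorus.word]
  have h2 := DFunLike.congr_fun h g
  have h3 : f g = 1 := by ext i; simp [f, hg]
  rw [MonoidHom.comp_apply, MonoidHom.comp_apply, h3, map_one] at h2
  exact (QuotientGroup.eq_one_iff _).1 h2

open MeasureTheory

/-- Normalized Haar measure on `𝕋ᵖ = (ℝ/ℤ)ᵖ`. -/
def torusHaar (p : ℕ) : Measure (UnitAddTorus (Fin p)) :=
  Measure.pi fun _ => AddCircle.haarAddCircle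

instance (p : ℕ) : IsProbabilityMeasure (torusHaar p) :=
  inferInstanceAs (IsProbabilityMeasure (Measure.pi fun _ : Fin p => AddCircle.haarAddCircle))

theorem integral_mFourier {k : Fin p → ℤ} (hk : k ≠ 0) :
    ∫ t, UnitAddTorus.mFourier k t ∂torusHaar p = 0 := by
  obtain ⟨i, hi⟩ := Function.ne_iff.1 hk
  have h : ∫ x : UnitAddCircle, fourier (k i) x ∂AddCircle.haarAddCircle = 0 := by
    have := orthonormal_iff_ite.1 (orthonormal_fourier (T := 1)) 0 (k i)
    rw [if_neg (fun h => hi h.symm), ContinuousMap.inner_toLp] at this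
    simpa using this
  change ∫ t : Fin p → UnitAddCircle, ∏ i, fourier (k i) (t i)
    ∂Measure.pi (fun _ : Fin p => AddCircle.haarAddCircle) = 0
  rw [integral_fintype_prod_eq_prod (fun i (x : UnitAddCircle) => (fourier (k i) x : ℂ))]
  exact Finset.prod_eq_zero (Finset.mem_univ i) h

theorem NCTorus.integrable_act (a : NCTorus ρ) :
    Integrable (fun t => NCTorus.act ρ t a) (torusHaar p) :=
  (NCTorus.continuous_act a).integrable_of_hasCompactSupport
    (HasCompactSupport.of_compactSpace _)

/-- The average `a ↦ ∫ γ_t(a) dt` over the action, as a linear map. -/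
def NCTorus.average (ρ : AntisymmBicharacter p) : NCTorus ρ →ₗ[ℂ] NCTorus ρ where
  toFun a := ∫ t, NCTorus.act ρ t a ∂torusHaar p
  map_add' a b := by
    simp_rw [map_add]
    exact integral_add (NCTorus.integrable_act a) (NCTorus.integrable_act b)
  map_smul' c a := by
    simp_rw [map_smul]
    exact integral_smul c _

theorem NCTorus.average_apply (a : NCTorus ρ) :
    NCTorus.average ρ a = ∫ t, NCTorus.act ρ t a ∂torusHaar p := rfl

theorem NCTorus.norm_average_le (a : NCTorus ρ) : ‖NCTorus.average ρ a‖ ≤ ‖a‖ := by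
  have := norm_integral_le_of_norm_le_const (μ := torusHaar p) (C := ‖a‖)
    (Filter.Eventually.of_forall fun t => NCTorus.norm_act_le t a)
  rw [NCTorus.average_apply]
  simpa using this

theorem NCTorus.average_mem (a : NCTorus ρ) :
    NCTorus.average ρ a ∈ Submodule.span ℂ {(1 : NCTorus ρ)} := by
  have hc : Continuous (NCTorus.average ρ) :=
    AddMonoidHomClass.continuous_of_bound _ 1 fun a => by
      simpa using NCTorus.norm_average_le a
  refine NCTorus.denseRange_ofFree.induction_on a
    ((Submodule.closed_of_finiteDimensional (Submodule.span ℂ {(1 : NCTorus ρ)})).preimage hc)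
    fun x => ?_
  induction x using MonoidAlgebra.induction_linear with
  | zero => simp
  | add x y hx hy => rw [map_add, map_add]; exact Submodule.add_mem _ hx hy
  | single g c =>
    rw [NCTorus.ofFree_single, map_smul]
    refine Submodule.smul_mem _ _ ?_
    change NCTorus.average ρ (NCTorus.word ρ g : NCTorus ρ) ∈ _
    by_cases hg : exponents p g = 1
    · obtain ⟨d, hd⟩ := NCTorus.word_mem_scalarUnitaries (ρ := ρ) hg
      rw [hd, Algebra.algebraMap_eq_smul_one, map_smul, NCTorus.average_apply]
      simp only [map_one, integral_const, probReal_univ, one_smul]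
      exact Submodule.smul_mem _ _ (Submodule.mem_span_singleton_self _)
    · have : NCTorus.average ρ (NCTorus.word ρ g : NCTorus ρ) = 0 := by
        rw [NCTorus.average_apply]
        simp_rw [NCTorus.act_word]
        rw [integral_smul_const, integral_mFourier, zero_smul]
        exact fun h => hg (by simpa using congrArg Multiplicative.ofAdd h)
      rw [this]
      exact Submodule.zero_mem _

theorem NCTorus.exists_average_eq (a : NCTorus ρ) :
    ∃ c : ℂ, algebraMap ℂ (NCTorus ρ) c = NCTorus.average ρ a := by
  obtain ⟨c, hc⟩ := Submodule.mem_span_singleton.1 (NCTorus.average_mem a)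
  exact ⟨c, by rw [Algebra.algebraMap_eq_smul_one, hc]⟩

/-- The scalar `τ(a)` with `τ(a) 1 = ∫ γ_t(a) dt`. -/
def NCTorus.traceFun (ρ : AntisymmBicharacter p) (a : NCTorus ρ) : ℂ :=
  (NCTorus.exists_average_eq a).choose

theorem NCTorus.algebraMap_traceFun (a : NCTorus ρ) :
    algebraMap ℂ (NCTorus ρ) (NCTorus.traceFun ρ a) =
      ∫ t, NCTorus.act ρ t a ∂torusHaar p := (NCTorus.exists_average_eq a).choose_spec

/-- The canonical tracial state `τ` of `A_ρ`: the positive linear functional with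
`τ(a) 1 = ∫ γ_t(a) dt`, the integral over `𝕋ᵖ` with normalized Haar measure. -/
def NCTorus.trace (ρ : AntisymmBicharacter p) : NCTorus ρ →ₚ[ℂ] ℂ :=
  PositiveLinearMap.mk₀
    { toFun := NCTorus.traceFun ρ
      map_add' := fun a b => (algebraMap ℂ (NCTorus ρ)).injective <| by
        simp only [map_add, NCTorus.algebraMap_traceFun]
        exact integral_add (NCTorus.integrable_act a) (NCTorus.integrable_act b)
      map_smul' := fun c a => (algebraMap ℂ (NCTorus ρ)).injective <| by
        simp only [RingHom.id_apply, smul_eq_mul, map_mul, NCTorus.algebraMap_traceFun]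
        rw [← Algebra.smul_def]
        simp_rw [map_smul]
        exact integral_smul c _ }
    fun a ha => by
      change 0 ≤ NCTorus.traceFun ρ a
      have h : 0 ≤ algebraMap ℂ (NCTorus ρ) (NCTorus.traceFun ρ a) := by
        rw [NCTorus.algebraMap_traceFun]
        exact integral_nonneg fun t => map_nonneg (NCTorus.act ρ t) ha
      exact spectrum_nonneg_of_nonneg h (by rw [spectrum.scalar_eq]; rfl)

theorem NCTorus.algebraMap_trace (a : NCTorus ρ) :
    algebraMap ℂ (NCTorus ρ) (NCTorus.trace ρ a) =
      ∫ t, NCTorus.act ρ t a ∂torusHaar p := NCTorus.algebraMap_traceFun a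

theorem NCTorus.trace_one : NCTorus.trace ρ 1 = 1 :=
  (algebraMap ℂ (NCTorus ρ)).injective <| by
    rw [NCTorus.algebraMap_trace]
    simp

/-- The length function on `𝕋ᵖ = ℝᵖ/ℤᵖ`: `2π` times the distance to `0` in the metric induced from
the Euclidean metric of `ℝᵖ` (`‖tᵢ‖` is the distance of `tᵢ` to `0` in `ℝ/ℤ`). -/
def torusLength (t : UnitAddTorus (Fin p)) : ℝ := 2 * Real.pi * √(∑ i, ‖t i‖ ^ 2)

/-- The seminorm `L(a) = sup_{t ≠ 0} ‖γ_t(a) - a‖ / ℓ(t)` on `A_ρ`, with values in `[0, ∞]`. -/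
def NCTorus.lipNorm (ρ : AntisymmBicharacter p) (a : NCTorus ρ) : ℝ≥0∞ :=
  ⨆ (t : UnitAddTorus (Fin p)) (_ : t ≠ 0),
    ENNReal.ofReal (‖NCTorus.act ρ t a - a‖ / torusLength t)

end Universal

section Entropy

/-- `Y ⊂_δ Z`: every point of `Y` is at distance less than `δ` from some point of `Z`. -/
def ApproxSubset {X : Type*} [NormedAddCommGroup X] (Y : Set X) (δ : ℝ) (Z : Set X) : Prop :=
  ∀ y ∈ Y, ∃ x ∈ Z, ‖y - x‖ < δ

/-- The least dimension of a finite-dimensional subspace which approximately contains `Z` to within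
`δ` (`⊤` if there is none). -/
def approxDim {X : Type*} [NormedAddCommGroup X] [NormedSpace ℂ X] (Z : Set X) (δ : ℝ) : ℕ∞ :=
  ⨅ (V : Submodule ℂ X) (_ : FiniteDimensional ℂ V ∧ ApproxSubset Z δ (V : Set X)),
    (Module.finrank ℂ V : ℕ∞)

variable {A : Type*} [CStarAlgebra A]

/-- The set `π_σ(Z) ξ_σ` in the GNS Hilbert space of `σ`. -/
def gnsOrbit [PartialOrder A] [StarOrderedRing A] (σ : A →ₚ[ℂ] ℂ) (Z : Set A) : Set σ.GNS :=
  (fun a => σ.gnsStarAlgHom a ((σ.toPreGNS 1 : σ.PreGNS) : σ.GNS)) '' Z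

/-- The set `Ω · α(Ω) · α²(Ω) ⋯ αⁿ⁻¹(Ω)` of products. -/
def productSet (α : A ≃⋆ₐ[ℂ] A) (Ω : Set A) (n : ℕ) : Set A :=
  {a | ∃ w : Fin n → A, (∀ j, w j ∈ Ω) ∧ a = (List.ofFn fun j => (α^[(j : ℕ)]) (w j)).prod}

/-- The automorphism `α` is bi-Lipschitz with respect to `L`. -/
def IsBiLipschitz (L : A → ℝ≥0∞) (α : A ≃⋆ₐ[ℂ] A) : Prop :=
  ∃ lam : NNReal, ∀ a, L a < ⊤ → L (α a) ≤ lam * L a ∧ L (α.symm a) ≤ lam * L a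

/-- The limit superior of `(1/n) log dₙ` in `[-∞, ∞]`. -/
def growthRate (d : ℕ → ℕ∞) : EReal :=
  Filter.limsup (fun n : ℕ => ENNReal.log (d n : ℝ≥0∞) / (n : EReal)) Filter.atTop

/-- The product entropy `Entp_L(α)`: the supremum over the finite subsets `Ω` of the unit ball
which consist of elements with `L(a) < ∞`, and over `δ > 0`, of the exponential growth rate of
`D(Ω · α(Ω) ⋯ αⁿ⁻¹(Ω), δ)`. -/
def productEntropy (L : A → ℝ≥0∞) (α : A ≃⋆ₐ[ℂ] A) : EReal :=
  ⨆ (Ω : Finset A) (_ : ∀ a ∈ Ω, L a < ⊤ ∧ ‖a‖ ≤ 1) (δ : ℝ) (_ : 0 < δ),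
    growthRate fun n => approxDim (productSet α (Ω : Set A) n) δ

/-- The product entropy `Entp_{L,σ}(α)` with respect to a state `σ`, with approximation in the GNS
Hilbert space of `σ`. -/
def stateProductEntropy [PartialOrder A] [StarOrderedRing A] (L : A → ℝ≥0∞) (σ : A →ₚ[ℂ] ℂ)
    (α : A ≃⋆ₐ[ℂ] A) : EReal :=
  ⨆ (Ω : Finset A) (_ : ∀ a ∈ Ω, L a < ⊤ ∧ ‖a‖ ≤ 1) (δ : ℝ) (_ : 0 < δ),
    growthRate fun n => approxDim (gnsOrbit σ (productSet α (Ω : Set A) n)) δ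

end Entropy

end

/-! For `α = Ad u` the product `a₁ α(a₂) ⋯ αⁿ⁻¹(aₙ)` telescopes: after right multiplication by `uⁿ`
it becomes `a₁ u a₂ u ⋯ aₙ u`. It is thus a product of contractions, and the Leibniz inequality for
`L` makes Lipschitz constants add on the unit ball. If `C` bounds the constants on `Ω` and `D` that
of `u`, the whole product has constant at most `n (C + 2 D)`: linear in `n`, where a general
bi-Lipschitz automorphism would only give an exponential bound
(`NCTorus.isActLipschitz_of_mem_productSet`).

Fejér means on the torus bring an element with Lipschitz constant `R` within `δ` of the span of the
monomials of degree `O((R/δ)²)` in each variable, a space of dimension polynomial in `R`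
(`approxDim_le_of_isActLipschitz`). The approximate dimension of the `n`-fold product set is
therefore polynomial in `n`, and its exponential growth rate is at most zero.

The GNS entropy is dominated by the norm entropy because `a ↦ π_τ(a) ξ_τ` is linear and contractive.
Both are nonnegative because `Ω = {1}` already forces dimension at least one.

Leibniz alone bounds `L(u a u*)` by `L(a) + 2 L(u) ‖a‖`, which is not a multiple of `L(a)`. Since
`Ad u` fixes scalars, `a` may be replaced by `a - τ(a)`, whose norm is at most `L(a)` times the
maximum of the length function. Invariance of `τ` is its trace property. -/

noncomputable section
open scoped ENNReal ComplexOrder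

open MeasureTheory

/-! ### Fejér kernels on the torus and their first moment. -/

section FejerKernel

/-- The Fejér kernel `x ↦ (1/N) |∑_{k < N} exp(2πikx)|²` on `ℝ/ℤ`. -/
def fejerKernel (N : ℕ) (x : UnitAddCircle) : ℝ :=
  (N : ℝ)⁻¹ * ‖∑ k ∈ Finset.range N, (fourier (k : ℤ) x : ℂ)‖ ^ 2

theorem fejerKernel_nonneg (N : ℕ) (x : UnitAddCircle) : 0 ≤ fejerKernel N x := by
  unfold fejerKernel
  positivity

theorem continuous_fejerKernel (N : ℕ) : Continuous (fejerKernel N) := by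
  unfold fejerKernel
  fun_prop

theorem integral_fourier_haarAddCircle (m : ℤ) :
    ∫ x : UnitAddCircle, (fourier m x : ℂ) ∂AddCircle.haarAddCircle = if m = 0 then 1 else 0 := by
  have := orthonormal_iff_ite.1 (orthonormal_fourier (T := 1)) 0 m
  rw [ContinuousMap.inner_toLp] at this
  simpa [eq_comm] using this

theorem ofReal_fejerKernel (N : ℕ) (x : UnitAddCircle) :
    (fejerKernel N x : ℂ) = (N : ℂ)⁻¹ * ∑ k ∈ Finset.range N, ∑ l ∈ Finset.range N,
      (fourier ((l : ℤ) - k) x : ℂ) := by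
  rw [fejerKernel]
  push_cast
  rw [← Complex.conj_mul', map_sum, Finset.sum_mul_sum]
  simp_rw [← fourier_neg, ← fourier_add, neg_add_eq_sub]

/-- Orthogonality of characters turns the coefficient into a count of pairs. Only two cases matter
later: `m = 0` gives `N` pairs, and `|m| ≥ N` gives none. -/
theorem integral_fejerKernel_mul_fourier (N : ℕ) (m : ℤ) :
    ∫ x : UnitAddCircle, (fejerKernel N x : ℂ) * fourier m x ∂AddCircle.haarAddCircle =
      (N : ℂ)⁻¹ * ∑ k ∈ Finset.range N, ∑ l ∈ Finset.range N,
        if (l : ℤ) - k + m = 0 then 1 else 0 := by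
  have hint : ∀ j : ℤ, Integrable (fun x : UnitAddCircle => (fourier j x : ℂ))
      AddCircle.haarAddCircle := fun j =>
    (ContinuousMap.continuous _).integrable_of_hasCompactSupport
      (HasCompactSupport.of_compactSpace _)
  simp_rw [ofReal_fejerKernel, mul_assoc, Finset.sum_mul, ← fourier_add]
  rw [integral_const_mul, integral_finsetSum _ fun k _ => integrable_finsetSum _ fun l _ => hint _]
  simp_rw [integral_finsetSum _ fun l _ => hint _, integral_fourier_haarAddCircle]

theorem integral_fejerKernel {N : ℕ} (hN : 0 < N) :
    ∫ x, fejerKernel N x ∂AddCircle.haarAddCircle = 1 := by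
  have h := integral_fejerKernel_mul_fourier N 0
  have h2 : ∀ k ∈ Finset.range N, (∑ l ∈ Finset.range N,
      if (l : ℤ) - k + 0 = 0 then (1 : ℂ) else 0) = 1 := by
    intro k hk
    rw [Finset.sum_eq_single_of_mem k hk fun l _ hl => if_neg (by omega)]
    simp
  rw [Finset.sum_congr rfl h2] at h
  simp only [fourier_zero, mul_one, integral_complex_ofReal, Finset.sum_const, Finset.card_range,
    nsmul_eq_mul] at h
  rw [inv_mul_cancel₀ (by exact_mod_cast hN.ne')] at h
  exact_mod_cast h

theorem integral_fejerKernel_mul_fourier_eq_zero {N : ℕ} {m : ℤ} (hm : (N : ℤ) ≤ |m|) :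
    ∫ x : UnitAddCircle, (fejerKernel N x : ℂ) * fourier m x ∂AddCircle.haarAddCircle = 0 := by
  rw [integral_fejerKernel_mul_fourier]
  refine mul_eq_zero_of_right _ (Finset.sum_eq_zero fun k hk => Finset.sum_eq_zero fun l hl =>
    if_neg fun h => ?_)
  rw [Finset.mem_range] at hk hl
  rcases le_total 0 m with h0 | h0
  · rw [abs_of_nonneg h0] at hm; omega
  · rw [abs_of_nonpos h0] at hm; omega

theorem norm_le_norm_fourier_one_sub_one (x : UnitAddCircle) :
    ‖x‖ ≤ ‖(fourier 1 x : ℂ) - 1‖ := by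
  obtain ⟨y, rfl⟩ := QuotientAddGroup.mk_surjective x
  -- The representative in `[-1/2, 1/2]` puts `π z` in `[-π/2, π/2]`, where Jordan's inequality for
  -- the sine applies.
  have hx : ((y : ℝ) : UnitAddCircle) = ((y - round y : ℝ) : UnitAddCircle) := by
    rw [AddCircle.coe_sub, eq_comm, sub_eq_self, AddCircle.coe_eq_zero_iff]
    exact ⟨round y, by simp⟩
  have hz := abs_sub_round y
  set z := y - round y with hzdef
  change ‖((y : ℝ) : UnitAddCircle)‖ ≤ ‖(fourier 1 ((y : ℝ) : UnitAddCircle) : ℂ) - 1‖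
  have h1 : ‖((y : ℝ) : UnitAddCircle)‖ = |z| := UnitAddCircle.norm_eq
  rw [h1, hx, fourier_coe_apply]
  have h2 : (2 * Real.pi * Complex.I * (1 : ℤ) * z / (1 : ℝ) : ℂ) =
      Complex.I * ((2 * Real.pi * z : ℝ) : ℂ) := by
    push_cast; ring
  rw [h2, Complex.norm_exp_I_mul_ofReal_sub_one, norm_mul, Real.norm_eq_abs, Real.norm_eq_abs,
    show 2 * Real.pi * z / 2 = Real.pi * z by ring]
  have hpi := Real.pi_pos
  have h3 : 2 / Real.pi * |Real.pi * z| ≤ |Real.sin (Real.pi * z)| := by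
    refine Real.mul_abs_le_abs_sin ?_
    rw [abs_mul, abs_of_pos hpi]
    nlinarith
  rw [abs_mul, abs_of_pos hpi, ← mul_assoc, div_mul_cancel₀ _ hpi.ne'] at h3
  rw [abs_of_pos (by norm_num : (0 : ℝ) < 2)]
  linarith [abs_nonneg z]

/-- The geometric sum times `exp(2πix) - 1` has modulus at most `2`, and `‖x‖` is dominated by the
modulus of the second factor. Squaring and dividing by `N` gives `4 / N`. -/
theorem fejerKernel_mul_norm_sq_le (N : ℕ) (x : UnitAddCircle) :
    fejerKernel N x * ‖x‖ ^ 2 ≤ 4 / N := by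
  have h1 : (∑ k ∈ Finset.range N, (fourier (k : ℤ) x : ℂ)) * ((fourier 1 x : ℂ) - 1) =
      fourier (N : ℤ) x - 1 := by
    have h : ∀ k : ℕ, (fourier (k : ℤ) x : ℂ) = (fourier 1 x : ℂ) ^ k := by
      intro k
      simp [fourier_apply, AddCircle.toCircle_nsmul]
    simp_rw [h]
    exact geom_sum_mul _ _
  have h2 : ‖∑ k ∈ Finset.range N, (fourier (k : ℤ) x : ℂ)‖ * ‖x‖ ≤ 2 := by
    calc _ ≤ ‖∑ k ∈ Finset.range N, (fourier (k : ℤ) x : ℂ)‖ * ‖(fourier 1 x : ℂ) - 1‖ := by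
          gcongr
          exact norm_le_norm_fourier_one_sub_one x
      _ = ‖(fourier (N : ℤ) x : ℂ) - 1‖ := by rw [← norm_mul, h1]
      _ ≤ ‖(fourier (N : ℤ) x : ℂ)‖ + ‖(1 : ℂ)‖ := norm_sub_le _ _
      _ = 2 := by rw [fourier_apply, Circle.norm_coe, norm_one]; norm_num
  rw [fejerKernel, mul_assoc, ← mul_pow, div_eq_inv_mul]
  have h3 : 0 ≤ ‖∑ k ∈ Finset.range N, (fourier (k : ℤ) x : ℂ)‖ * ‖x‖ := by positivity
  gcongr
  nlinarith

variable {p : ℕ}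

/-- The Fejér kernel on `𝕋ᵖ`. -/
def torusFejerKernel (p N : ℕ) (t : UnitAddTorus (Fin p)) : ℝ := ∏ i, fejerKernel N (t i)

theorem torusFejerKernel_nonneg (N : ℕ) (t : UnitAddTorus (Fin p)) :
    0 ≤ torusFejerKernel p N t := Finset.prod_nonneg fun _ _ => fejerKernel_nonneg N _

theorem continuous_torusFejerKernel (p N : ℕ) : Continuous (torusFejerKernel p N) :=
  continuous_finsetProd _ fun i _ => (continuous_fejerKernel N).comp (continuous_apply i)

theorem Continuous.integrable_torusHaar {E : Type*} [NormedAddCommGroup E]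
    {f : UnitAddTorus (Fin p) → E} (hf : Continuous f) : Integrable f (torusHaar p) :=
  hf.integrable_of_hasCompactSupport (HasCompactSupport.of_compactSpace _)

theorem integral_torusFejerKernel {N : ℕ} (hN : 0 < N) :
    ∫ t, torusFejerKernel p N t ∂torusHaar p = 1 := by
  unfold torusFejerKernel torusHaar
  rw [integral_fintype_prod_eq_prod fun (_ : Fin p) (x : UnitAddCircle) => fejerKernel N x]
  simp [integral_fejerKernel hN]

theorem integral_torusFejerKernel_mul_mFourier_eq_zero {N : ℕ} {k : Fin p → ℤ} {i : Fin p}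
    (hi : (N : ℤ) ≤ |k i|) :
    ∫ t, (torusFejerKernel p N t : ℂ) * UnitAddTorus.mFourier k t ∂torusHaar p = 0 := by
  have h : ∀ t : UnitAddTorus (Fin p), (torusFejerKernel p N t : ℂ) * UnitAddTorus.mFourier k t =
      ∏ i, (fejerKernel N (t i) : ℂ) * fourier (k i) (t i) := by
    intro t
    rw [Finset.prod_mul_distrib, torusFejerKernel]
    push_cast
    rfl
  simp_rw [h]
  unfold torusHaar
  rw [integral_fintype_prod_eq_prod fun (i : Fin p) (x : UnitAddCircle) =>
    (fejerKernel N x : ℂ) * fourier (k i) x]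
  exact Finset.prod_eq_zero (Finset.mem_univ i) (integral_fejerKernel_mul_fourier_eq_zero hi)

theorem integral_torusFejerKernel_mul_norm_sq_le {N : ℕ} (hN : 0 < N) (i : Fin p) :
    ∫ t, torusFejerKernel p N t * ‖t i‖ ^ 2 ∂torusHaar p ≤ 4 / N := by
  -- Padding with factors `1` makes the integrand a product over coordinates; Fubini leaves only the
  -- `i`-th integral, as the others are `1`.
  have h : ∀ t : UnitAddTorus (Fin p), torusFejerKernel p N t * ‖t i‖ ^ 2 =
      ∏ j, fejerKernel N (t j) * (if j = i then ‖t j‖ ^ 2 else 1) := by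
    intro t
    rw [Finset.prod_mul_distrib, torusFejerKernel]
    simp
  simp_rw [h]
  unfold torusHaar
  rw [integral_fintype_prod_eq_prod fun (j : Fin p) (x : UnitAddCircle) =>
    fejerKernel N x * (if j = i then ‖x‖ ^ 2 else 1), Finset.prod_eq_single_of_mem i
    (Finset.mem_univ i) fun j _ hj => by simp [hj, integral_fejerKernel hN]]
  simp only [if_true]
  calc ∫ x, fejerKernel N x * ‖x‖ ^ 2 ∂AddCircle.haarAddCircle
      ≤ ∫ _x : UnitAddCircle, (4 / N : ℝ) ∂AddCircle.haarAddCircle := by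
        refine integral_mono ?_ (integrable_const _) fun x => fejerKernel_mul_norm_sq_le N x
        exact ((continuous_fejerKernel N).mul (by fun_prop)).integrable_of_hasCompactSupport
          (HasCompactSupport.of_compactSpace _)
    _ = 4 / N := by simp

theorem continuous_torusLength : Continuous (torusLength (p := p)) := by
  unfold torusLength
  fun_prop

theorem torusLength_nonneg (t : UnitAddTorus (Fin p)) : 0 ≤ torusLength t := by
  unfold torusLength
  positivity

theorem torusLength_zero : torusLength (0 : UnitAddTorus (Fin p)) = 0 := by
  simp [torusLength]

theorem torusLength_pos {t : UnitAddTorus (Fin p)} (ht : t ≠ 0) : 0 < torusLength t := by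
  obtain ⟨i, hi⟩ := Function.ne_iff.1 ht
  have h : 0 < ∑ i, ‖t i‖ ^ 2 := Finset.sum_pos' (fun _ _ => by positivity)
    ⟨i, Finset.mem_univ i, by have := norm_pos_iff.2 hi; positivity⟩
  unfold torusLength
  have := Real.pi_pos
  positivity

/-- The inequality `2 s ≤ 1/m + m s²` replaces the square root by second moments, which the product
kernel can integrate coordinatewise. -/
theorem torusLength_le {m : ℝ} (hm : 0 < m) (t : UnitAddTorus (Fin p)) :
    torusLength t ≤ Real.pi * (m⁻¹ + m * ∑ i, ‖t i‖ ^ 2) := by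
  unfold torusLength
  have h0 : 0 ≤ ∑ i, ‖t i‖ ^ 2 := by positivity
  have h1 := Real.sq_sqrt h0
  set s := √(∑ i, ‖t i‖ ^ 2)
  rw [← h1, mul_comm 2 Real.pi, mul_assoc]
  refine mul_le_mul_of_nonneg_left ?_ Real.pi_pos.le
  have h2 : m⁻¹ + m * s ^ 2 - 2 * s = m⁻¹ * (1 - m * s) ^ 2 := by
    field_simp
    ring
  have h3 : 0 ≤ m⁻¹ * (1 - m * s) ^ 2 := by positivity
  linarith

/-- Order `m ^ 2` makes each second moment at most `4 / m²`, so that both terms of `torusLength_le`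
are of order `1 / m`. The rate is not optimal, but any power rate suffices. -/
theorem integral_torusFejerKernel_mul_torusLength_le {m : ℕ} (hm : 0 < m) :
    ∫ t, torusFejerKernel p (m ^ 2) t * torusLength t ∂torusHaar p ≤
      Real.pi * (1 + 4 * p) / m := by
  have hm' : (0 : ℝ) < m := by exact_mod_cast hm
  have hK := continuous_torusFejerKernel p (m ^ 2)
  have hi : ∀ i : Fin p, Integrable (fun t => torusFejerKernel p (m ^ 2) t * ‖t i‖ ^ 2)
      (torusHaar p) := fun i => Continuous.integrable_torusHaar (by fun_prop)
  calc ∫ t, torusFejerKernel p (m ^ 2) t * torusLength t ∂torusHaar p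
      ≤ ∫ t, Real.pi * ((m : ℝ)⁻¹ * torusFejerKernel p (m ^ 2) t +
          m * ∑ i, torusFejerKernel p (m ^ 2) t * ‖t i‖ ^ 2) ∂torusHaar p := by
        refine integral_mono (Continuous.integrable_torusHaar (hK.mul continuous_torusLength))
          (Continuous.integrable_torusHaar (by fun_prop)) fun t => ?_
        refine (mul_le_mul_of_nonneg_left (torusLength_le hm' t)
          (torusFejerKernel_nonneg _ t)).trans_eq ?_
        rw [← Finset.mul_sum]
        ring
    _ = Real.pi * ((m : ℝ)⁻¹ +
          m * ∑ i, ∫ t, torusFejerKernel p (m ^ 2) t * ‖t i‖ ^ 2 ∂torusHaar p) := by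
        rw [integral_const_mul, integral_add (hK.integrable_torusHaar.const_mul _)
          ((integrable_finsetSum _ fun i _ => hi i).const_mul _), integral_const_mul,
          integral_const_mul, integral_torusFejerKernel (by positivity), mul_one,
          integral_finsetSum _ fun i _ => hi i]
    _ ≤ Real.pi * ((m : ℝ)⁻¹ + m * ∑ _i : Fin p, 4 / ((m ^ 2 : ℕ) : ℝ)) := by
        gcongr with i
        exact integral_torusFejerKernel_mul_norm_sq_le (by positivity) i
    _ = Real.pi * (1 + 4 * p) / m := by
        simp
        field_simp

end FejerKernel

/-! ### Lipschitz elements, bi-Lipschitz conjugation and the trace property. -/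

section Lipschitz
variable {p : ℕ} {ρ : AntisymmBicharacter p}

/-- The element `a` of `A_ρ` satisfies `‖γ_t(a) - a‖ ≤ C ℓ(t)` for all `t`. -/
def NCTorus.IsActLipschitz (C : ℝ) (a : NCTorus ρ) : Prop :=
  ∀ t, ‖NCTorus.act ρ t a - a‖ ≤ C * torusLength t

theorem NCTorus.isActLipschitz_of_lipNorm_lt_top {a : NCTorus ρ} (ha : NCTorus.lipNorm ρ a < ⊤) :
    NCTorus.IsActLipschitz (NCTorus.lipNorm ρ a).toReal a := by
  intro t
  -- The supremum defining `L` omits `t = 0`, so there the bound needs that `γ₀` is the identity,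
  -- checked on words and extended by density.
  by_cases ht : t = 0
  · subst ht
    have h : ∀ b : NCTorus ρ, NCTorus.act ρ 0 b = b := by
      intro b
      refine NCTorus.denseRange_ofFree.induction_on b (isClosed_eq ?_ continuous_id) fun x => ?_
      · exact AddMonoidHomClass.continuous_of_bound (NCTorus.act ρ 0) 1 fun a => by
          simpa using NCTorus.norm_act_le 0 a
      · induction x using MonoidAlgebra.induction_linear with
        | zero => simp
        | add x y hx hy => rw [map_add, map_add, hx, hy]
        | single g c =>
          rw [NCTorus.ofFree_single, map_smul]
          change c • NCTorus.act ρ 0 (NCTorus.word ρ g) = c • (NCTorus.word ρ g : NCTorus ρ)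
          rw [NCTorus.act_word]
          simp [UnitAddTorus.mFourier]
    rw [h, sub_self, norm_zero, torusLength_zero, mul_zero]
  · have h1 : ENNReal.ofReal (‖NCTorus.act ρ t a - a‖ / torusLength t) ≤ NCTorus.lipNorm ρ a :=
      le_iSup₂ (f := fun (t : UnitAddTorus (Fin p)) (_ : t ≠ 0) =>
        ENNReal.ofReal (‖NCTorus.act ρ t a - a‖ / torusLength t)) t ht
    rw [ENNReal.ofReal_le_iff_le_toReal ha.ne] at h1
    exact (div_le_iff₀ (torusLength_pos ht)).1 h1

theorem NCTorus.IsActLipschitz.lipNorm_le {C : ℝ} {a : NCTorus ρ}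
    (h : NCTorus.IsActLipschitz C a) : NCTorus.lipNorm ρ a ≤ ENNReal.ofReal C :=
  iSup₂_le fun t ht => ENNReal.ofReal_le_ofReal ((div_le_iff₀ (torusLength_pos ht)).2 (h t))

theorem NCTorus.IsActLipschitz.mono {C D : ℝ} {a : NCTorus ρ}
    (h : NCTorus.IsActLipschitz C a) (hCD : C ≤ D) : NCTorus.IsActLipschitz D a := fun t =>
  (h t).trans (mul_le_mul_of_nonneg_right hCD (torusLength_nonneg t))

/-- The Leibniz inequality: `γ_t` is multiplicative and contractive. -/
theorem NCTorus.IsActLipschitz.mul {C D : ℝ} {a b : NCTorus ρ}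
    (ha : NCTorus.IsActLipschitz C a) (hb : NCTorus.IsActLipschitz D b) :
    NCTorus.IsActLipschitz (C * ‖b‖ + ‖a‖ * D) (a * b) := by
  intro t
  have h : NCTorus.act ρ t (a * b) - a * b =
      (NCTorus.act ρ t a - a) * NCTorus.act ρ t b + a * (NCTorus.act ρ t b - b) := by
    rw [map_mul, sub_mul, mul_sub]
    abel
  have h1 := ha t
  have h2 := hb t
  calc ‖NCTorus.act ρ t (a * b) - a * b‖
      ≤ ‖NCTorus.act ρ t a - a‖ * ‖NCTorus.act ρ t b‖ + ‖a‖ * ‖NCTorus.act ρ t b - b‖ := by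
        rw [h]
        exact (norm_add_le _ _).trans (add_le_add (norm_mul_le _ _) (norm_mul_le _ _))
    _ ≤ C * torusLength t * ‖b‖ + ‖a‖ * (D * torusLength t) := by
        refine add_le_add (mul_le_mul h1 (NCTorus.norm_act_le t b) (norm_nonneg _)
          ((norm_nonneg _).trans h1)) (mul_le_mul_of_nonneg_left h2 (norm_nonneg _))
    _ = _ := by ring

/-- Additivity of the constants on the unit ball is what makes long products grow only linearly. -/
theorem NCTorus.IsActLipschitz.mul_of_norm_le_one {C D : ℝ} {a b : NCTorus ρ} (hC : 0 ≤ C)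
    (hD : 0 ≤ D) (ha : NCTorus.IsActLipschitz C a) (hb : NCTorus.IsActLipschitz D b)
    (ha1 : ‖a‖ ≤ 1) (hb1 : ‖b‖ ≤ 1) : NCTorus.IsActLipschitz (C + D) (a * b) :=
  (ha.mul hb).mono (add_le_add (mul_le_of_le_one_right hC hb1) (mul_le_of_le_one_left hD ha1))

theorem NCTorus.IsActLipschitz.star {C : ℝ} {a : NCTorus ρ} (ha : NCTorus.IsActLipschitz C a) :
    NCTorus.IsActLipschitz C (star a) := by
  intro t
  rw [map_star, ← star_sub, norm_star]
  exact ha t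

theorem NCTorus.isActLipschitz_one : NCTorus.IsActLipschitz 0 (1 : NCTorus ρ) := by
  intro t
  simp

theorem NCTorus.IsActLipschitz.pow {C : ℝ} {a : NCTorus ρ} (hC : 0 ≤ C)
    (ha : NCTorus.IsActLipschitz C a) (ha1 : ‖a‖ ≤ 1) (n : ℕ) :
    NCTorus.IsActLipschitz (n * C) (a ^ n) := by
  induction n with
  | zero => simpa using NCTorus.isActLipschitz_one
  | succ n ih =>
    have h := ih.mul_of_norm_le_one (by positivity) hC ha (by
      have := norm_pow_le a n
      exact this.trans (pow_le_one₀ (norm_nonneg _) ha1)) ha1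
    rw [pow_succ]
    exact h.mono (by push_cast; linarith)

theorem NCTorus.IsActLipschitz.sub_algebraMap {C : ℝ} {a : NCTorus ρ}
    (ha : NCTorus.IsActLipschitz C a) (c : ℂ) :
    NCTorus.IsActLipschitz C (a - algebraMap ℂ (NCTorus ρ) c) := by
  intro t
  rw [map_sub, AlgHomClass.commutes, sub_sub_sub_cancel_right]
  exact ha t

theorem exists_torusLength_le (p : ℕ) :
    ∃ M, 0 ≤ M ∧ ∀ t : UnitAddTorus (Fin p), torusLength t ≤ M := by
  obtain ⟨M, hM⟩ := isCompact_univ.exists_bound_of_continuousOn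
    (continuous_torusLength (p := p)).continuousOn
  exact ⟨M, (norm_nonneg _).trans (hM 0 trivial), fun t => (le_abs_self _).trans (hM t trivial)⟩

/-- The difference is the average of `a - γ_t(a)` over the torus. -/
theorem NCTorus.IsActLipschitz.norm_sub_trace_le {C M : ℝ} {a : NCTorus ρ} (hC : 0 ≤ C)
    (hM : ∀ t : UnitAddTorus (Fin p), torusLength t ≤ M) (ha : NCTorus.IsActLipschitz C a) :
    ‖a - algebraMap ℂ (NCTorus ρ) (NCTorus.trace ρ a)‖ ≤ C * M := by
  have h : a - algebraMap ℂ (NCTorus ρ) (NCTorus.trace ρ a) =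
      ∫ t, (a - NCTorus.act ρ t a) ∂torusHaar p := by
    rw [integral_sub (integrable_const _) (NCTorus.integrable_act a), NCTorus.algebraMap_trace]
    simp
  rw [h]
  have := norm_integral_le_of_norm_le_const (μ := torusHaar p) (C := C * M)
    (f := fun t => a - NCTorus.act ρ t a) (Filter.Eventually.of_forall fun t => by
      rw [norm_sub_rev]
      exact (ha t).trans (mul_le_mul_of_nonneg_left (hM t) hC))
  simpa using this

theorem NCTorus.norm_unitary (u : unitary (NCTorus ρ)) : ‖(u : NCTorus ρ)‖ = 1 :=
  CStarRing.norm_coe_unitary u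

/-- Conjugation by a Lipschitz unitary increases Lipschitz constants by at most a fixed factor. -/
theorem NCTorus.lipNorm_conj_le {C M : ℝ} {u : unitary (NCTorus ρ)} (hC : 0 ≤ C) (hM0 : 0 ≤ M)
    (hM : ∀ t : UnitAddTorus (Fin p), torusLength t ≤ M)
    (hu : NCTorus.IsActLipschitz C (u : NCTorus ρ)) {a : NCTorus ρ}
    (ha : NCTorus.lipNorm ρ a < ⊤) :
    NCTorus.lipNorm ρ (Unitary.conjStarAlgAut ℂ (NCTorus ρ) u a) ≤
      (1 + 2 * C * M).toNNReal * NCTorus.lipNorm ρ a := by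
  have ha' := NCTorus.isActLipschitz_of_lipNorm_lt_top ha
  set D := (NCTorus.lipNorm ρ a).toReal with hD
  have hD0 : 0 ≤ D := ENNReal.toReal_nonneg
  set c := NCTorus.trace ρ a
  have hb := ha'.sub_algebraMap c
  have hbn := ha'.norm_sub_trace_le hD0 hM
  set b := a - algebraMap ℂ (NCTorus ρ) c with hbdef
  -- Conjugation fixes the scalar part, so only the centred element `b`, with `‖b‖ ≤ D M`, meets the
  -- Leibniz inequality.
  have hab : Unitary.conjStarAlgAut ℂ (NCTorus ρ) u a =
      u * b * star (u : NCTorus ρ) + algebraMap ℂ (NCTorus ρ) c := by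
    rw [show a = b + algebraMap ℂ (NCTorus ρ) c by simp [hbdef], map_add, AlgHomClass.commutes]
    simp
  have h1 := (hu.mul hb).mul hu.star
  have h2 : NCTorus.IsActLipschitz ((1 + 2 * C * M) * D)
      (Unitary.conjStarAlgAut ℂ (NCTorus ρ) u a) := by
    have h3 := h1.sub_algebraMap (-c)
    rw [map_neg, sub_neg_eq_add, ← hab] at h3
    -- Leibniz gives `2 C ‖b‖ + D`, and `‖b‖ ≤ D M` turns this into a multiple of `D`.
    refine h3.mono ?_
    have h4 : ‖(u : NCTorus ρ) * b‖ = ‖b‖ := CStarRing.norm_coe_unitary_mul u b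
    rw [norm_star, NCTorus.norm_unitary, h4]
    nlinarith [mul_le_mul_of_nonneg_left hbn hC]
  refine h2.lipNorm_le.trans_eq ?_
  rw [ENNReal.ofReal_mul (by positivity), hD, ENNReal.ofReal_toReal ha.ne]
  rfl

theorem NCTorus.isBiLipschitz_conj {u : unitary (NCTorus ρ)}
    (hu : NCTorus.lipNorm ρ (u : NCTorus ρ) < ⊤) :
    IsBiLipschitz (NCTorus.lipNorm ρ) (Unitary.conjStarAlgAut ℂ (NCTorus ρ) u) := by
  have hu' := NCTorus.isActLipschitz_of_lipNorm_lt_top hu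
  obtain ⟨M, hM0, hM⟩ := exists_torusLength_le p
  refine ⟨_, fun a ha => ⟨NCTorus.lipNorm_conj_le ENNReal.toReal_nonneg hM0 hM hu' ha, ?_⟩⟩
  rw [Unitary.conjStarAlgAut_symm]
  exact NCTorus.lipNorm_conj_le ENNReal.toReal_nonneg hM0 hM
    (by rw [Unitary.coe_star]; exact hu'.star) ha

theorem NCTorus.continuous_trace : Continuous (NCTorus.trace ρ) := by
  refine AddMonoidHomClass.continuous_of_bound (NCTorus.trace ρ) 1 fun a => ?_
  rw [← norm_algebraMap' (NCTorus ρ), NCTorus.algebraMap_trace, one_mul]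
  exact NCTorus.norm_average_le a

theorem NCTorus.trace_word_of_ne {g : FreeGroup (Fin p)} (hg : exponents p g ≠ 1) :
    NCTorus.trace ρ (NCTorus.word ρ g) = 0 := by
  refine (algebraMap ℂ (NCTorus ρ)).injective ?_
  rw [NCTorus.algebraMap_trace]
  simp_rw [NCTorus.act_word]
  rw [integral_smul_const, integral_mFourier, zero_smul, map_zero]
  exact fun h => hg (by simpa using congrArg Multiplicative.ofAdd h)

/-- The words `gh` and `hg` have equal exponents. If these are nonzero, both traces vanish;
otherwise `gh` is a scalar and its conjugate `hg = h (gh) h⁻¹` is the same scalar. -/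
theorem NCTorus.trace_word_mul_comm (g h : FreeGroup (Fin p)) :
    NCTorus.trace ρ (NCTorus.word ρ g * NCTorus.word ρ h : NCTorus ρ) =
      NCTorus.trace ρ (NCTorus.word ρ h * NCTorus.word ρ g : NCTorus ρ) := by
  rw [← Submonoid.coe_mul, ← Submonoid.coe_mul, ← map_mul, ← map_mul]
  by_cases hgh : exponents p (g * h) = 1
  · obtain ⟨c, hc⟩ := NCTorus.word_mem_scalarUnitaries (ρ := ρ) hgh
    have h1 : NCTorus.word ρ (h * g) = NCTorus.word ρ h * NCTorus.word ρ (g * h) *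
        (NCTorus.word ρ h)⁻¹ := by
      rw [map_mul, map_mul, mul_assoc, mul_inv_cancel_right]
    rw [h1, Submonoid.coe_mul, Submonoid.coe_mul, hc, ← Algebra.commutes, mul_assoc,
      ← Submonoid.coe_mul, mul_inv_cancel]
    simp
  · rw [NCTorus.trace_word_of_ne hgh, NCTorus.trace_word_of_ne]
    rwa [map_mul, mul_comm, ← map_mul]

theorem NCTorus.trace_mul_comm (a b : NCTorus ρ) :
    NCTorus.trace ρ (a * b) = NCTorus.trace ρ (b * a) := by
  have hc := NCTorus.continuous_trace (ρ := ρ)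
  refine NCTorus.denseRange_ofFree.induction_on₂
    (p := fun a b => NCTorus.trace ρ (a * b) = NCTorus.trace ρ (b * a)) ?_ ?_ a b
  · exact isClosed_eq (by fun_prop) (by fun_prop)
  · intro x y
    induction x using MonoidAlgebra.induction_linear with
    | zero => simp
    | add x x' hx hx' => simp only [map_add, add_mul, mul_add, hx, hx']
    | single g c =>
      induction y using MonoidAlgebra.induction_linear with
      | zero => simp
      | add y y' hy hy' => simp only [map_add, add_mul, mul_add, hy, hy']
      | single h d =>
        rw [NCTorus.ofFree_single, NCTorus.ofFree_single, smul_mul_smul_comm, smul_mul_smul_comm,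
          map_smul, map_smul, mul_comm c d]
        congr 1
        exact NCTorus.trace_word_mul_comm g h

theorem NCTorus.trace_conj (u : unitary (NCTorus ρ)) (a : NCTorus ρ) :
    NCTorus.trace ρ (Unitary.conjStarAlgAut ℂ (NCTorus ρ) u a) = NCTorus.trace ρ a := by
  rw [Unitary.conjStarAlgAut_apply, NCTorus.trace_mul_comm, ← mul_assoc, Unitary.coe_star_mul_self,
    one_mul]

end Lipschitz

/-! ### Approximation by noncommutative trigonometric polynomials. -/

section FourierApproximation
variable {p : ℕ} {ρ : AntisymmBicharacter p}

/-- The Fejér mean `a ↦ ∫ K_N(t) γ_t(a) dt`. -/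
def NCTorus.fejerMean (ρ : AntisymmBicharacter p) (N : ℕ) : NCTorus ρ →ₗ[ℂ] NCTorus ρ where
  toFun a := ∫ t, (torusFejerKernel p N t : ℂ) • NCTorus.act ρ t a ∂torusHaar p
  map_add' a b := by
    have hK := Complex.continuous_ofReal.comp (continuous_torusFejerKernel p N)
    simp_rw [map_add, smul_add]
    exact integral_add (hK.smul (NCTorus.continuous_act a)).integrable_torusHaar
      (hK.smul (NCTorus.continuous_act b)).integrable_torusHaar
  map_smul' c a := by
    simp_rw [map_smul, smul_comm _ c]
    exact integral_smul c _

theorem NCTorus.fejerMean_apply (N : ℕ) (a : NCTorus ρ) : NCTorus.fejerMean ρ N a =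
    ∫ t, (torusFejerKernel p N t : ℂ) • NCTorus.act ρ t a ∂torusHaar p := rfl

theorem norm_ofReal_torusFejerKernel (N : ℕ) (t : UnitAddTorus (Fin p)) :
    ‖(torusFejerKernel p N t : ℂ)‖ = torusFejerKernel p N t := by
  rw [Complex.norm_real, Real.norm_of_nonneg (torusFejerKernel_nonneg N t)]

theorem NCTorus.norm_fejerMean_le {N : ℕ} (hN : 0 < N) (a : NCTorus ρ) :
    ‖NCTorus.fejerMean ρ N a‖ ≤ ‖a‖ := by
  rw [NCTorus.fejerMean_apply]
  refine (norm_integral_le_of_norm_le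
    ((continuous_torusFejerKernel p N).integrable_torusHaar.mul_const ‖a‖)
    (Filter.Eventually.of_forall fun t => ?_)).trans_eq ?_
  · rw [norm_smul, norm_ofReal_torusFejerKernel]
    exact mul_le_mul_of_nonneg_left (NCTorus.norm_act_le t a) (torusFejerKernel_nonneg N t)
  · rw [integral_mul_const, integral_torusFejerKernel hN, one_mul]

/-- As the kernel has mass one, the error is the kernel average of `a - γ_t(a)`, bounded by `C`
times the first moment of the length. -/
theorem NCTorus.norm_sub_fejerMean_le {C : ℝ} {a : NCTorus ρ}
    (ha : NCTorus.IsActLipschitz C a) {m : ℕ} (hm : 0 < m) (hC : 0 ≤ C) :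
    ‖a - NCTorus.fejerMean ρ (m ^ 2) a‖ ≤ C * (Real.pi * (1 + 4 * p) / m) := by
  have hK := continuous_torusFejerKernel p (m ^ 2)
  have hKc := Complex.continuous_ofReal.comp hK
  have h1 : a = ∫ t, (torusFejerKernel p (m ^ 2) t : ℂ) • a ∂torusHaar p := by
    rw [integral_smul_const, integral_complex_ofReal, integral_torusFejerKernel (by positivity)]
    simp
  have h2 : a - NCTorus.fejerMean ρ (m ^ 2) a =
      ∫ t, (torusFejerKernel p (m ^ 2) t : ℂ) • (a - NCTorus.act ρ t a) ∂torusHaar p := by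
    simp_rw [smul_sub]
    exact (congrArg (· - NCTorus.fejerMean ρ (m ^ 2) a) h1).trans
      (integral_sub (hKc.smul continuous_const).integrable_torusHaar
        (hKc.smul (NCTorus.continuous_act a)).integrable_torusHaar).symm
  rw [h2]
  refine (norm_integral_le_of_norm_le
    ((hK.mul continuous_torusLength).integrable_torusHaar.const_mul C)
    (Filter.Eventually.of_forall fun t => ?_)).trans ?_
  · rw [norm_smul, norm_ofReal_torusFejerKernel, norm_sub_rev, Pi.mul_apply, mul_left_comm]
    exact mul_le_mul_of_nonneg_left (ha t) (torusFejerKernel_nonneg _ t)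
  · refine (integral_const_mul C _).trans_le ?_
    exact mul_le_mul_of_nonneg_left (integral_torusFejerKernel_mul_torusLength_le hm) hC

/-- A word in the free group with the given exponents. -/
def wordOfExponents (k : Fin p → ℤ) : FreeGroup (Fin p) :=
  Function.invFun (fun g => (exponents p g).toAdd) k

/-- Restricting to exponents of actual words avoids proving that `exponents` is surjective. -/
theorem exponents_wordOfExponents (g : FreeGroup (Fin p)) :
    exponents p (wordOfExponents (exponents p g).toAdd) = exponents p g :=
  congrArg Multiplicative.ofAdd
    (Function.invFun_eq (f := fun g => (exponents p g).toAdd) ⟨g, rfl⟩)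

/-- The word `g h⁻¹` has zero exponents and is therefore a scalar in `A_ρ`. -/
theorem NCTorus.word_mem_span_of_exponents_eq {g h : FreeGroup (Fin p)}
    (hgh : exponents p g = exponents p h) :
    (NCTorus.word ρ g : NCTorus ρ) ∈ Submodule.span ℂ {(NCTorus.word ρ h : NCTorus ρ)} := by
  obtain ⟨c, hc⟩ := NCTorus.word_mem_scalarUnitaries (ρ := ρ) (g := g * h⁻¹) (by simp [hgh])
  have h1 : NCTorus.word ρ g = NCTorus.word ρ (g * h⁻¹) * NCTorus.word ρ h := by
    rw [← map_mul, inv_mul_cancel_right]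
  rw [h1, Submonoid.coe_mul, hc, ← Algebra.smul_def]
  exact Submodule.smul_mem _ _ (Submodule.mem_span_singleton_self _)

/-- The span of the monomials whose exponents are all less than `N` in absolute value. -/
def NCTorus.fourierSpan (ρ : AntisymmBicharacter p) (N : ℕ) : Submodule ℂ (NCTorus ρ) :=
  Submodule.span ℂ (Set.range fun k : Fin p → Finset.Ioo (-N : ℤ) N =>
    (NCTorus.word ρ (wordOfExponents fun i => k i) : NCTorus ρ))

instance (N : ℕ) : FiniteDimensional ℂ (NCTorus.fourierSpan ρ N) :=
  FiniteDimensional.span_of_finite ℂ (Set.finite_range _)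

theorem NCTorus.finrank_fourierSpan_le (N : ℕ) :
    Module.finrank ℂ (NCTorus.fourierSpan ρ N) ≤ (2 * N) ^ p := by
  refine (finrank_range_le_card _).trans ?_
  rw [Fintype.card_fun, Fintype.card_coe, Int.card_Ioo, Fintype.card_fin]
  exact Nat.pow_le_pow_left (by omega) p

theorem NCTorus.word_mem_fourierSpan {N : ℕ} {g : FreeGroup (Fin p)}
    (hg : ∀ i, |(exponents p g).toAdd i| < N) :
    (NCTorus.word ρ g : NCTorus ρ) ∈ NCTorus.fourierSpan ρ N := by
  refine Submodule.span_mono (Set.singleton_subset_iff.2 ?_)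
    (NCTorus.word_mem_span_of_exponents_eq (exponents_wordOfExponents g).symm)
  exact ⟨fun i => ⟨(exponents p g).toAdd i, Finset.mem_Ioo.2 (abs_lt.1 (hg i))⟩, rfl⟩

/-- On a word the mean is multiplication by a Fourier coefficient of the kernel, which vanishes once
some exponent reaches `N`. Density suffices because the mean is contractive and finite-dimensional
subspaces are closed. -/
theorem NCTorus.fejerMean_mem_fourierSpan {N : ℕ} (hN : 0 < N) (a : NCTorus ρ) :
    NCTorus.fejerMean ρ N a ∈ NCTorus.fourierSpan ρ N := by
  have hc : Continuous (NCTorus.fejerMean ρ N) :=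
    AddMonoidHomClass.continuous_of_bound _ 1 fun a => by
      simpa using NCTorus.norm_fejerMean_le hN a
  refine NCTorus.denseRange_ofFree.induction_on a
    ((Submodule.closed_of_finiteDimensional (NCTorus.fourierSpan ρ N)).preimage hc) fun x => ?_
  induction x using MonoidAlgebra.induction_linear with
  | zero => simp
  | add x y hx hy => rw [map_add, map_add]; exact Submodule.add_mem _ hx hy
  | single g c =>
    rw [NCTorus.ofFree_single, map_smul]
    refine Submodule.smul_mem _ _ ?_
    change NCTorus.fejerMean ρ N (NCTorus.word ρ g : NCTorus ρ) ∈ _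
    rw [NCTorus.fejerMean_apply]
    simp_rw [NCTorus.act_word, smul_smul]
    rw [integral_smul_const]
    by_cases hg : ∀ i, |(exponents p g).toAdd i| < N
    · exact Submodule.smul_mem _ _ (NCTorus.word_mem_fourierSpan hg)
    · push Not at hg
      obtain ⟨i, hi⟩ := hg
      rw [integral_torusFejerKernel_mul_mFourier_eq_zero hi, zero_smul]
      exact Submodule.zero_mem _

theorem approxDim_le_of_isActLipschitz {Z : Set (NCTorus ρ)} {C δ : ℝ} {m : ℕ} (hm : 0 < m)
    (hC : 0 ≤ C) (hZ : ∀ z ∈ Z, NCTorus.IsActLipschitz C z)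
    (hδ : C * (Real.pi * (1 + 4 * p) / m) < δ) :
    approxDim Z δ ≤ ((2 * m ^ 2) ^ p : ℕ) := by
  have h : ApproxSubset Z δ (NCTorus.fourierSpan ρ (m ^ 2)) := fun z hz =>
    ⟨_, NCTorus.fejerMean_mem_fourierSpan (by positivity) z,
      (NCTorus.norm_sub_fejerMean_le (hZ z hz) hm hC).trans_lt hδ⟩
  refine (iInf₂_le (NCTorus.fourierSpan ρ (m ^ 2)) ⟨inferInstance, h⟩).trans ?_
  exact_mod_cast NCTorus.finrank_fourierSpan_le (m ^ 2)

end FourierApproximation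

/-! ### Telescoping of products of conjugates. -/

section Products
variable {p : ℕ} {ρ : AntisymmBicharacter p}

theorem conjStarAlgAut_iterate {A : Type*} [CStarAlgebra A] (u : unitary A) (n : ℕ) (a : A) :
    (Unitary.conjStarAlgAut ℂ A u)^[n] a = (u : A) ^ n * a * star (u : A) ^ n := by
  induction n with
  | zero => simp
  | succ n ih =>
    rw [Function.iterate_succ_apply', ih, Unitary.conjStarAlgAut_apply, pow_succ', pow_succ]
    simp only [mul_assoc]

theorem pow_star_mul_pow {A : Type*} [CStarAlgebra A] (u : unitary A) (n : ℕ) :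
    star (u : A) ^ n * (u : A) ^ n = 1 := by
  rw [← star_pow, ← SubmonoidClass.coe_pow, Unitary.coe_star_mul_self]

theorem pow_mul_pow_star {A : Type*} [CStarAlgebra A] (u : unitary A) (n : ℕ) :
    (u : A) ^ n * star (u : A) ^ n = 1 := by
  rw [← star_pow, ← SubmonoidClass.coe_pow, ← Unitary.coe_star, Unitary.coe_mul_star_self]

/-- The factor `uⁿ` turns the product into `w₀ u w₁ u ⋯ wₙ₋₁ u`, with `n` blocks of constant `C +
D`. The norm bound is carried along because additivity of the constants needs it. -/
theorem NCTorus.isActLipschitz_prod_mul_pow {C D : ℝ} (hC : 0 ≤ C) (hD : 0 ≤ D)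
    {u : unitary (NCTorus ρ)} (hu : NCTorus.IsActLipschitz D (u : NCTorus ρ)) (n : ℕ) :
    ∀ w : Fin n → NCTorus ρ, (∀ j, NCTorus.IsActLipschitz C (w j) ∧ ‖w j‖ ≤ 1) →
      NCTorus.IsActLipschitz (n * (C + D)) ((List.ofFn fun j : Fin n =>
        ((Unitary.conjStarAlgAut ℂ (NCTorus ρ) u)^[(j : ℕ)]) (w j)).prod * (u : NCTorus ρ) ^ n) ∧
      ‖(List.ofFn fun j : Fin n =>
        ((Unitary.conjStarAlgAut ℂ (NCTorus ρ) u)^[(j : ℕ)]) (w j)).prod *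
          (u : NCTorus ρ) ^ n‖ ≤ 1 := by
  induction n with
  | zero =>
    intro w _
    simpa using NCTorus.isActLipschitz_one
  | succ n ih =>
    intro w hw
    obtain ⟨h1, h2⟩ := ih (fun j => w j.castSucc) fun j => hw j.castSucc
    obtain ⟨h3, h4⟩ := hw (Fin.last n)
    have hu1 := (NCTorus.norm_unitary u).le
    rw [List.ofFn_succ', List.concat_eq_append, List.prod_append, List.prod_singleton]
    simp only [Fin.val_castSucc, Fin.val_last]
    rw [conjStarAlgAut_iterate u n (w (Fin.last n))]
    set P := (List.ofFn fun j : Fin n =>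
      ((Unitary.conjStarAlgAut ℂ (NCTorus ρ) u)^[(j : ℕ)]) (w j.castSucc)).prod
    -- The new `u*ⁿ` cancels against `uⁿ⁺¹`, leaving the previous product times one more block `w
    -- u`.
    have h5 : P * ((u : NCTorus ρ) ^ n * w (Fin.last n) * star (u : NCTorus ρ) ^ n) *
        (u : NCTorus ρ) ^ (n + 1) = P * (u : NCTorus ρ) ^ n * (w (Fin.last n) * u) := by
      rw [pow_succ (u : NCTorus ρ) n]
      simp only [mul_assoc]
      rw [← mul_assoc (star (u : NCTorus ρ) ^ n), pow_star_mul_pow, one_mul]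
    have h6 : ‖w (Fin.last n) * (u : NCTorus ρ)‖ ≤ 1 := by
      rw [CStarRing.norm_mul_coe_unitary]
      exact h4
    rw [h5]
    refine ⟨?_, (norm_mul_le _ _).trans (mul_le_one₀ h2 (norm_nonneg _) h6)⟩
    refine (h1.mul_of_norm_le_one (by positivity) (by positivity)
      (h3.mul_of_norm_le_one hC hD hu h4 hu1) h2 h6).mono ?_
    push_cast
    linarith

theorem NCTorus.isActLipschitz_of_mem_productSet {C D : ℝ} (hC : 0 ≤ C) (hD : 0 ≤ D)
    {u : unitary (NCTorus ρ)} (hu : NCTorus.IsActLipschitz D (u : NCTorus ρ))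
    {Ω : Set (NCTorus ρ)} (hΩ : ∀ a ∈ Ω, NCTorus.IsActLipschitz C a ∧ ‖a‖ ≤ 1) {n : ℕ}
    {a : NCTorus ρ} (ha : a ∈ productSet (Unitary.conjStarAlgAut ℂ (NCTorus ρ) u) Ω n) :
    NCTorus.IsActLipschitz (n * (C + 2 * D)) a := by
  obtain ⟨w, hw, rfl⟩ := ha
  obtain ⟨h1, h2⟩ := NCTorus.isActLipschitz_prod_mul_pow hC hD hu n w fun j => hΩ _ (hw j)
  have hs : ‖star (u : NCTorus ρ)‖ ≤ 1 := by rw [norm_star, NCTorus.norm_unitary]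
  -- Undoing the factor `uⁿ` by `u*ⁿ` costs a further `n D`, hence `C + 2 D`.
  have h3 := h1.mul_of_norm_le_one (by positivity) (by positivity) (hu.star.pow hD hs n) h2
    ((norm_pow_le _ n).trans (pow_le_one₀ (norm_nonneg _) hs))
  rw [mul_assoc, pow_mul_pow_star, mul_one] at h3
  exact h3.mono (by linarith)

end Products

/-! ### Growth rates and the two entropies. -/

section Entropy

theorem approxDim_image_le {X Y : Type*} [NormedAddCommGroup X] [NormedSpace ℂ X]
    [NormedAddCommGroup Y] [NormedSpace ℂ Y] (T : X →ₗ[ℂ] Y) (hT : ∀ x, ‖T x‖ ≤ ‖x‖) (Z : Set X)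
    (δ : ℝ) : approxDim (T '' Z) δ ≤ approxDim Z δ := by
  refine le_iInf₂ fun V hV => ?_
  have := hV.1
  have h : ApproxSubset (T '' Z) δ (V.map T : Set Y) := by
    rintro _ ⟨z, hz, rfl⟩
    obtain ⟨x, hx, hzx⟩ := hV.2 z hz
    refine ⟨T x, Submodule.mem_map_of_mem hx, ?_⟩
    rw [← map_sub]
    exact (hT _).trans_lt hzx
  refine (iInf₂_le (V.map T) ⟨inferInstance, h⟩).trans ?_
  exact_mod_cast Submodule.finrank_map_le T V

/-- The zero subspace fails because approximation is strict, so `δ = ‖z‖` is allowed. -/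
theorem one_le_approxDim {X : Type*} [NormedAddCommGroup X] [NormedSpace ℂ X] {Z : Set X} {δ : ℝ}
    {z : X} (hz : z ∈ Z) (hδ : δ ≤ ‖z‖) : 1 ≤ approxDim Z δ := by
  refine le_iInf₂ fun V hV => ?_
  have := hV.1
  obtain ⟨x, hx, hzx⟩ := hV.2 z hz
  rw [Nat.one_le_cast, Nat.one_le_iff_ne_zero]
  intro h
  rw [Submodule.finrank_eq_zero] at h
  rw [h, SetLike.mem_coe, Submodule.mem_bot] at hx
  rw [hx, sub_zero] at hzx
  exact hzx.not_ge hδ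

theorem growthRate_mono {d e : ℕ → ℕ∞} (h : ∀ n, d n ≤ e n) : growthRate d ≤ growthRate e :=
  Filter.limsup_le_limsup (Filter.Eventually.of_forall fun n =>
    EReal.div_le_div_right_of_nonneg (by positivity)
      (ENNReal.log_le_log (by exact_mod_cast h n)))

theorem growthRate_nonneg {d : ℕ → ℕ∞} (h : ∀ n, 1 ≤ d n) : 0 ≤ growthRate d := by
  refine (Filter.limsup_const (f := Filter.atTop (α := ℕ)) (0 : EReal)).ge.trans
    (Filter.limsup_le_limsup (Filter.Eventually.of_forall fun n => ?_))
  refine EReal.div_nonneg ?_ (by positivity)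
  rw [← ENNReal.log_one]
  exact ENNReal.log_le_log (by exact_mod_cast h n)

theorem growthRate_le_zero_of_polynomial {d : ℕ → ℕ∞} {c q : ℕ} (hc : 0 < c)
    (h : ∀ n, 0 < n → d n ≤ ((c * n) ^ q : ℕ)) : growthRate d ≤ 0 := by
  have h1 : Filter.Tendsto (fun n : ℕ => q * (Real.log c / n + Real.log n / n)) Filter.atTop
      (nhds (q * (0 + 0))) :=
    ((tendsto_const_div_atTop_nhds_zero_nat _).add
      ((Real.isLittleO_log_id_atTop.tendsto_div_nhds_zero).comp
        tendsto_natCast_atTop_atTop)).const_mul _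
  rw [add_zero, mul_zero] at h1
  have h2 := (EReal.tendsto_coe.2 h1).limsup_eq
  rw [EReal.coe_zero] at h2
  rw [← h2]
  refine Filter.limsup_le_limsup ((Filter.eventually_gt_atTop 0).mono fun n hn => ?_)
  have h3 : ENNReal.log (d n : ℝ≥0∞) ≤ (q * (Real.log c + Real.log n) : ℝ) := by
    have h4 : (0 : ℝ) < ((c * n) ^ q : ℕ) := by positivity
    have h5 : (d n : ℝ≥0∞) ≤ ENNReal.ofReal ((c * n) ^ q : ℕ) := by
      rw [ENNReal.ofReal_natCast]
      exact_mod_cast h n hn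
    refine (ENNReal.log_le_log h5).trans_eq ?_
    rw [ENNReal.log_ofReal_of_pos h4]
    push_cast
    rw [Real.log_pow, Real.log_mul (by positivity) (by positivity)]
    norm_cast
  refine (EReal.div_le_div_right_of_nonneg (by positivity) h3).trans_eq ?_
  rw [← EReal.coe_coe_eq_natCast, ← EReal.coe_div]
  congr 1
  ring

variable {p : ℕ} {ρ : AntisymmBicharacter p}

theorem NCTorus.growthRate_productSet_conj_le {u : unitary (NCTorus ρ)}
    (hu : NCTorus.lipNorm ρ (u : NCTorus ρ) < ⊤) (Ω : Finset (NCTorus ρ))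
    (hΩ : ∀ a ∈ Ω, NCTorus.lipNorm ρ a < ⊤ ∧ ‖a‖ ≤ 1) {δ : ℝ} (hδ : 0 < δ) :
    growthRate (fun n => approxDim
      (productSet (Unitary.conjStarAlgAut ℂ (NCTorus ρ) u) (Ω : Set (NCTorus ρ)) n) δ) ≤ 0 := by
  have hu' := NCTorus.isActLipschitz_of_lipNorm_lt_top hu
  set D := (NCTorus.lipNorm ρ (u : NCTorus ρ)).toReal
  -- The sum serves as a common Lipschitz bound on the finite set, and it is defined also when `Ω`
  -- is empty.
  set C := ∑ a ∈ Ω, (NCTorus.lipNorm ρ a).toReal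
  have hD : 0 ≤ D := ENNReal.toReal_nonneg
  have hC : 0 ≤ C := Finset.sum_nonneg fun _ _ => ENNReal.toReal_nonneg
  have hΩ' : ∀ a ∈ (Ω : Set (NCTorus ρ)), NCTorus.IsActLipschitz C a ∧ ‖a‖ ≤ 1 := fun a ha =>
    ⟨(NCTorus.isActLipschitz_of_lipNorm_lt_top (hΩ a ha).1).mono
      (Finset.single_le_sum (f := fun a => (NCTorus.lipNorm ρ a).toReal)
        (fun _ _ => ENNReal.toReal_nonneg) ha), (hΩ a ha).2⟩
  clear_value C D
  obtain ⟨m, hm⟩ := exists_nat_gt ((C + 2 * D) * (Real.pi * (1 + 4 * p)) / δ)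
  have hpi := Real.pi_pos
  have hm0 : (0 : ℝ) < m := lt_of_le_of_lt (by positivity) hm
  have hm1 : 0 < m := by exact_mod_cast hm0
  refine growthRate_le_zero_of_polynomial (c := 2 * m) (q := 2 * p) (by positivity) fun n hn => ?_
  have hn0 : (0 : ℝ) < n := by exact_mod_cast hn
  -- The parameter `m * n` absorbs the linear growth of the Lipschitz constant: `n` cancels, and the
  -- error is the quantity made less than `δ` by the choice of `m`.
  refine (approxDim_le_of_isActLipschitz (m := m * n) (by positivity) (by positivity)
    (fun z hz => NCTorus.isActLipschitz_of_mem_productSet hC hD hu' hΩ' hz) ?_).trans ?_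
  · rw [div_lt_iff₀ hδ] at hm
    push_cast
    rw [show n * (C + 2 * D) * (Real.pi * (1 + 4 * p) / (m * n)) =
      (C + 2 * D) * (Real.pi * (1 + 4 * p)) / m by field_simp, div_lt_iff₀ hm0]
    linarith
  · rw [pow_mul]
    norm_cast
    refine Nat.pow_le_pow_left ?_ p
    nlinarith [sq_nonneg (m * n)]

theorem NCTorus.productEntropy_conj_le {u : unitary (NCTorus ρ)}
    (hu : NCTorus.lipNorm ρ (u : NCTorus ρ) < ⊤) :
    productEntropy (NCTorus.lipNorm ρ) (Unitary.conjStarAlgAut ℂ (NCTorus ρ) u) ≤ 0 :=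
  iSup₂_le fun Ω hΩ => iSup₂_le fun _ hδ => NCTorus.growthRate_productSet_conj_le hu Ω hΩ hδ

theorem productSet_singleton_one {A : Type*} [CStarAlgebra A] (α : A ≃⋆ₐ[ℂ] A) (n : ℕ) :
    (1 : A) ∈ productSet α {1} n := by
  refine ⟨fun _ => 1, fun _ => rfl, ?_⟩
  have h : ∀ j, α^[j] 1 = 1 := fun j => Function.iterate_fixed (map_one α) j
  simp [h]

theorem NCTorus.lipNorm_one_lt_top : NCTorus.lipNorm ρ 1 < ⊤ :=
  NCTorus.isActLipschitz_one.lipNorm_le.trans_lt ENNReal.ofReal_lt_top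

/-- With `Ω = {1}` every product set contains `1`, a vector of norm one, so `δ = 1` already forces
positive dimension. -/
theorem NCTorus.productEntropy_nonneg (α : NCTorus ρ ≃⋆ₐ[ℂ] NCTorus ρ) :
    0 ≤ productEntropy (NCTorus.lipNorm ρ) α := by
  refine le_iSup₂_of_le {1} (fun a ha => ?_) (le_iSup₂_of_le 1 one_pos
    (growthRate_nonneg fun n => ?_))
  · rw [Finset.mem_singleton.1 ha]
    exact ⟨NCTorus.lipNorm_one_lt_top, norm_one.le⟩
  · rw [Finset.coe_singleton]
    exact one_le_approxDim (productSet_singleton_one α n) norm_one.ge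

/-- The map `a ↦ π_σ(a) ξ_σ` into the GNS Hilbert space. -/
def gnsVector {A : Type*} [CStarAlgebra A] [PartialOrder A] [StarOrderedRing A] (σ : A →ₚ[ℂ] ℂ) :
    A →ₗ[ℂ] σ.GNS where
  toFun a := σ.gnsStarAlgHom a ((σ.toPreGNS 1 : σ.PreGNS) : σ.GNS)
  map_add' a b := by rw [map_add]; rfl
  map_smul' c a := by rw [map_smul]; rfl

theorem NCTorus.norm_cyclicVector :
    ‖(((NCTorus.trace ρ).toPreGNS 1 : (NCTorus.trace ρ).PreGNS) : (NCTorus.trace ρ).GNS)‖ = 1 := by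
  rw [UniformSpace.Completion.norm_coe, PositiveLinearMap.preGNS_norm_def]
  simp [NCTorus.trace_one]

/-- The GNS representation is contractive and the cyclic vector has norm one; this is what carries
approximating subspaces of `A_ρ` to the Hilbert space. -/
theorem NCTorus.norm_gnsVector_le (a : NCTorus ρ) : ‖gnsVector (NCTorus.trace ρ) a‖ ≤ ‖a‖ := by
  refine (ContinuousLinearMap.le_opNorm ((NCTorus.trace ρ).gnsStarAlgHom a) _).trans ?_
  rw [NCTorus.norm_cyclicVector, mul_one]
  exact NonUnitalStarAlgHom.norm_apply_le _ a

theorem NCTorus.stateProductEntropy_le (α : NCTorus ρ ≃⋆ₐ[ℂ] NCTorus ρ) :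
    stateProductEntropy (NCTorus.lipNorm ρ) (NCTorus.trace ρ) α ≤
      productEntropy (NCTorus.lipNorm ρ) α :=
  iSup₂_mono fun _ _ => iSup₂_mono fun δ _ => growthRate_mono fun _ =>
    approxDim_image_le (gnsVector (NCTorus.trace ρ)) NCTorus.norm_gnsVector_le _ δ

theorem NCTorus.stateProductEntropy_nonneg (α : NCTorus ρ ≃⋆ₐ[ℂ] NCTorus ρ) :
    0 ≤ stateProductEntropy (NCTorus.lipNorm ρ) (NCTorus.trace ρ) α := by
  refine le_iSup₂_of_le {1} (fun a ha => ?_) (le_iSup₂_of_le 1 one_pos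
    (growthRate_nonneg fun n => ?_))
  · rw [Finset.mem_singleton.1 ha]
    exact ⟨NCTorus.lipNorm_one_lt_top, norm_one.le⟩
  · rw [Finset.coe_singleton]
    refine one_le_approxDim ⟨1, productSet_singleton_one α n, rfl⟩ ?_
    simp only [map_one]
    exact NCTorus.norm_cyclicVector.ge

end Entropy

theorem mainTheorem3 (p : ℕ) (ρ : AntisymmBicharacter p) (u : unitary (NCTorus ρ))
    (hu : NCTorus.lipNorm ρ (u : NCTorus ρ) < ⊤) :
    IsBiLipschitz (NCTorus.lipNorm ρ) (Unitary.conjStarAlgAut ℂ (NCTorus ρ) u) ∧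
    (∀ a : NCTorus ρ,
      NCTorus.trace ρ (Unitary.conjStarAlgAut ℂ (NCTorus ρ) u a) = NCTorus.trace ρ a) ∧
    productEntropy (NCTorus.lipNorm ρ) (Unitary.conjStarAlgAut ℂ (NCTorus ρ) u) = 0 ∧
    stateProductEntropy (NCTorus.lipNorm ρ) (NCTorus.trace ρ)
      (Unitary.conjStarAlgAut ℂ (NCTorus ρ) u) = 0 := by
  have h := NCTorus.productEntropy_conj_le hu
  exact ⟨NCTorus.isBiLipschitz_conj hu, NCTorus.trace_conj u,
    le_antisymm h (NCTorus.productEntropy_nonneg _),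
    le_antisymm ((NCTorus.stateProductEntropy_le _).trans h)
      (NCTorus.stateProductEntropy_nonneg _)⟩

end
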